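/- Let $\mathbb K=\mathbb R$ (smooth functions) or $\mathbb K=\mathbb C$ (holomorphic functions). \textbf{Weights.} Let $\alpha_1,\dots,\alpha_n$ be formal generators of one common parity $\varepsilon\in\mathbb Z_2$. Let $\Delta_n\subset\mathbb Z^n$ be the set of multiplicity-free weights, i.e. of sums of distinct $\alpha_i$. The length $\sharp\delta$ of $\delta\in\Delta_n$ is its number of summands, and its parity is $\sharp\delta\cdot\varepsilon$. Let $\Delta\subset\Delta_n$ be $S_n$-invariant with $0\in\Delta$, and let $L=\Delta/S_n$. We identify $L$ with the set of lengths $k=\sharp\delta$, $\delta\in\Delta$; weight $k$ has parity $k\varepsilon$. \textbf{Graded domains.} A graded domain of type $L$ (resp. $\Delta$) is a ringed space $(\mathcal U_0,\mathcal F_{\mathcal U_0}\otimes S)$. Here $\mathcal U_0$ is open in $\mathbb K^{n_0}$, $\mathcal F$ is the sheaf of smooth or holomorphic functions, the tensor product is one of sheaves, and $S$ is the super-symmetric $\mathbb K$-algebra on finitely many graded coordinates whose weights are nonzero elements of $L$ (resp. $\Delta$). There are $n_k\ge 0$ (resp. $n_\delta\geq 0$) coordinates of each such weight, with the parity of that weight.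 It is $\mathbb Z$-graded (resp. $\mathbb Z^n$-graded). \textbf{Manifolds.} A graded manifold $\mathcal D$ of type $\Delta$ is a $\mathbb Z^n$-graded ringed space over $\mathbb K$ that is locally isomorphic to graded domains of type $\Delta$ of fixed dimensions. Its morphisms are the morphisms of $\mathbb Z^n$-graded ringed spaces that are local on functions of weight $0$. Multiplicity-free manifolds of type $\Delta$ are the spaces $\widehat{\mathcal D}=(\mathcal D_0,\mathcal O_{\mathcal D}/\mathcal I_{\mathcal D})$, where $\mathcal I_{\mathcal D}$ is the sheaf of ideals generated locally by the homogeneous sections whose weight is not in $\Delta_n$. Their morphisms are the maps $\widehat\Phi$ induced by morphisms $\Phi$ of graded manifolds of type $\Delta$. A morphism from a multiplicity-free manifold $\mathcal M$ of type $\Delta$ to a graded domain of type $L$ is a morphism of ringed spaces over $\mathbb K$ whose underlying map is smooth (holomorphic) and which preserves the $\mathbb Z$-grading, where $(\mathcal O_{\mathcal M})_k=\bigoplus_{\delta\in\Delta_n,\,\sharp\delta=k}(\mathcal O_{\mathcal M})_\delta$. \textbf{Theorem.} Let $\mathcal U$ be a graded domain of type $L$ with coordinates $(x_i,\xi^k_j)$,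 $1\le i\le n_0$, $1\le j\le n_k$, $k\in L\setminus\{0\}$. Let $\mathcal V$ be the multiplicity-free domain of type $\Delta$ with the same base $\mathcal V_0=\mathcal U_0$ and with coordinates $(y_i,t^\delta_j)$, $1\le i\le n_0$, $1\le j\le n_{\sharp\delta}$, $\delta\in\Delta\setminus\{0\}$. Then $\mathcal V$ is a multiplicity-free manifold of type $\Delta$, and there is a unique morphism $\mathsf p:\mathcal V\to\mathcal U$ with $$\mathsf p^*(x_i)=y_i,\qquad \mathsf p^*(\xi^k_j)=\sum_{\delta\in\Delta,\ \sharp\delta=k}t^\delta_j .$$ For every multiplicity-free manifold $\mathcal M$ of type $\Delta$ and every morphism $\psi:\mathcal M\to\mathcal U$ there exists a unique morphism $\Psi:\mathcal M\to\mathcal V$ of multiplicity-free manifolds with $\mathsf p\circ\Psi=\psi$. -/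

import Mathlib

open CategoryTheory TopologicalSpace Opposite
open scoped ContDiff

noncomputable section

namespace MultFree

/-! ### The super-symmetric algebra on homogeneous generators -/

section SuperSym

variable (𝕜 : Type) [RCLike 𝕜] {ι : Type}

/-- The supercommutation relations `v_i v_j = (-1)^(|i||j|) v_j v_i`. -/
inductive SuperRel (par : ι → ZMod 2) : FreeAlgebra 𝕜 ι → FreeAlgebra 𝕜 ι → Prop
  | comm (i j : ι) : SuperRel par (FreeAlgebra.ι 𝕜 i * FreeAlgebra.ι 𝕜 j)
      (((-1 : 𝕜) ^ ((par i).val * (par j).val)) • (FreeAlgebra.ι 𝕜 j * FreeAlgebra.ι 𝕜 i))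

/-- The super-symmetric algebra over `𝕜` on generators indexed by `ι`, of parities `par`. -/
abbrev SuperSym (par : ι → ZMod 2) : Type := RingQuot (SuperRel 𝕜 par)

/-- The generators of the super-symmetric algebra. -/
def SuperSym.gen (par : ι → ZMod 2) (i : ι) : SuperSym 𝕜 par :=
  RingQuot.mkAlgHom 𝕜 (SuperRel 𝕜 par) (FreeAlgebra.ι 𝕜 i)

/-- The elements of weight `g`: the span of the products of generators of total weight `g`. -/
def SuperSym.homog (par : ι → ZMod 2) {G : Type} [AddCommGroup G] (wt : ι → G) (g : G) :
    Submodule 𝕜 (SuperSym 𝕜 par) :=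
  Submodule.span 𝕜
    {s | ∃ l : List ι, (l.map wt).sum = g ∧ s = (l.map (SuperSym.gen 𝕜 par)).prod}

variable {𝕜}

theorem SuperSym.one_mem_homog (par : ι → ZMod 2) {G : Type} [AddCommGroup G] (wt : ι → G) :
    (1 : SuperSym 𝕜 par) ∈ SuperSym.homog 𝕜 par wt 0 :=
  Submodule.subset_span ⟨[], by simp, by simp⟩

theorem SuperSym.mul_mem_homog (par : ι → ZMod 2) {G : Type} [AddCommGroup G] (wt : ι → G)
    {g h : G} {a b : SuperSym 𝕜 par} (ha : a ∈ SuperSym.homog 𝕜 par wt g)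
    (hb : b ∈ SuperSym.homog 𝕜 par wt h) : a * b ∈ SuperSym.homog 𝕜 par wt (g + h) := by
  have key : SuperSym.homog 𝕜 par wt g * SuperSym.homog 𝕜 par wt h
      ≤ SuperSym.homog 𝕜 par wt (g + h) := by
    unfold SuperSym.homog
    rw [Submodule.span_mul_span]
    apply Submodule.span_mono
    rintro _ ⟨_, ⟨l, hl, rfl⟩, _, ⟨l', hl', rfl⟩, rfl⟩
    exact ⟨l ++ l', by simp [hl, hl'], by simp⟩
  exact key (Submodule.mul_mem_mul ha hb)

end SuperSym

/-! ### Graded ringed spaces -/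

/-- A ringed space over `𝕜` (a space with a sheaf of associative `𝕜`-algebras). -/
abbrev RSpace (𝕜 : Type) [RCLike 𝕜] : Type 1 := AlgebraicGeometry.SheafedSpace.{1, 0, 0} (AlgCat.{0} 𝕜)

/-- Sections over an open set. -/
abbrev RSpace.sec {𝕜 : Type} [RCLike 𝕜] (X : RSpace 𝕜) (W : Opens X) : Type :=
  X.presheaf.obj (op W)

/-- Restriction of sections. -/
def RSpace.res {𝕜 : Type} [RCLike 𝕜] (X : RSpace 𝕜) {W W' : Opens X} (h : W' ≤ W) :
    X.sec W →ₐ[𝕜] X.sec W' :=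
  (X.presheaf.map (homOfLE h).op).hom

/-- The underlying map of a morphism of ringed spaces. -/
def RSpace.base {𝕜 : Type} [RCLike 𝕜] {X Y : RSpace 𝕜} (f : X ⟶ Y) (x : X) : Y := f.hom.base x

/-- The preimage of an open set under a morphism of ringed spaces. -/
abbrev RSpace.preim {𝕜 : Type} [RCLike 𝕜] {X Y : RSpace 𝕜} (f : X ⟶ Y) (W : Opens Y) : Opens X :=
  (Opens.map f.hom.base).obj W

/-- Pullback of sections along a morphism of ringed spaces. -/
def RSpace.pull {𝕜 : Type} [RCLike 𝕜] {X Y : RSpace 𝕜} (f : X ⟶ Y) (W : Opens Y) :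
    Y.sec W →ₐ[𝕜] X.sec (RSpace.preim f W) :=
  (f.hom.c.app (op W)).hom

/-- A `G`-graded ringed space: a ringed space with subsheaves of homogeneous sections of every
weight, compatible with multiplication. For the spaces considered below (which are locally
isomorphic to graded domains) every section is locally a finite sum of homogeneous ones, in a
unique way; parities are determined by weights. -/
structure GradedSpace (𝕜 : Type) [RCLike 𝕜] (G : Type) [AddCommGroup G] where
  space : RSpace 𝕜
  homog : ∀ W : Opens space, G → Submodule 𝕜 (space.sec W)
  res_mem : ∀ {W W' : Opens space} (h : W' ≤ W) {g : G} {s : space.sec W},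
    s ∈ homog W g → space.res h s ∈ homog W' g
  local_mem : ∀ {W : Opens space} {g : G} (s : space.sec W),
    (∀ x ∈ W, ∃ (W' : Opens space) (h : W' ≤ W), x ∈ W' ∧ space.res h s ∈ homog W' g) →
      s ∈ homog W g
  one_mem : ∀ W : Opens space, (1 : space.sec W) ∈ homog W 0
  mul_mem : ∀ {W : Opens space} {g h : G} {s t : space.sec W},
    s ∈ homog W g → t ∈ homog W h → s * t ∈ homog W (g + h)

/-- A morphism of `G`-graded ringed spaces, local on functions of weight `0`: if the pullback of
a function of weight `0` is invertible near `x`, then the function is invertible near the image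
of `x`. -/
structure IsGradedMorphism {𝕜 : Type} [RCLike 𝕜] {G : Type} [AddCommGroup G]
    {X Y : GradedSpace 𝕜 G} (f : X.space ⟶ Y.space) : Prop where
  weight : ∀ (W : Opens Y.space) (g : G) (s : Y.space.sec W), s ∈ Y.homog W g →
    RSpace.pull f W s ∈ X.homog (RSpace.preim f W) g
  isLocal : ∀ (W : Opens Y.space) (s : Y.space.sec W), s ∈ Y.homog W 0 →
    ∀ x ∈ RSpace.preim f W,
      (∃ (A : Opens X.space) (hA : A ≤ RSpace.preim f W), x ∈ A ∧
        ∃ t ∈ X.homog A 0, X.space.res hA (RSpace.pull f W s) * t = 1) →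
      ∃ (B : Opens Y.space) (hB : B ≤ W), RSpace.base f x ∈ B ∧
        ∃ t ∈ Y.homog B 0, Y.space.res hB s * t = 1

/-! ### Graded domains -/

section Domain

variable {𝕜 : Type} [RCLike 𝕜] {N : ℕ} {ι : Type}

/-- The value of a section of the structure sheaf `F ⊗ S` at a point; a family of values over
`W` is a section iff locally it is a finite sum `∑ g_i s_i` with smooth (holomorphic) functions
`g_i` and constant elements `s_i` of the super-symmetric algebra `S`. -/
def IsDomainSection (par : ι → ZMod 2) (U : Opens (Fin N → 𝕜)) (W : Opens U)
    (f : W → SuperSym 𝕜 par) : Prop :=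
  ∀ x : W, ∃ (W' : Opens U) (h : W' ≤ W), x.1 ∈ W' ∧
    ∃ (κ : Type) (_ : Fintype κ) (g : κ → (Fin N → 𝕜) → 𝕜) (s : κ → SuperSym 𝕜 par),
      (∀ k, ContDiffOn 𝕜 ∞ (g k) (Subtype.val '' (W' : Set U))) ∧
      ∀ y : W', f ⟨y.1, h y.2⟩ = ∑ k, g k y.1.1 • s k

/-- The algebra of sections of `F ⊗ S` over `W`. -/
def domainSections (par : ι → ZMod 2) (U : Opens (Fin N → 𝕜)) (W : Opens U) :
    Subalgebra 𝕜 (W → SuperSym 𝕜 par) where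
  carrier := {f | IsDomainSection par U W f}
  mul_mem' := by
    rintro a b ha hb x
    obtain ⟨A, hA, hxA, κ, _, g, s, hg, ha⟩ := ha x
    obtain ⟨B, hB, hxB, κ', _, g', s', hg', hb⟩ := hb x
    refine ⟨A ⊓ B, inf_le_left.trans hA, ⟨hxA, hxB⟩, κ × κ', inferInstance,
      fun k y => g k.1 y * g' k.2 y, fun k => s k.1 * s' k.2, fun k => ?_, fun y => ?_⟩
    · exact ((hg k.1).mono (Set.image_mono fun z hz => hz.1)).mul
        ((hg' k.2).mono (Set.image_mono fun z hz => hz.2))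
    · have e1 := ha ⟨y.1, y.2.1⟩
      have e2 := hb ⟨y.1, y.2.2⟩
      simp only at e1 e2
      rw [Pi.mul_apply, e1, e2, Finset.sum_mul_sum, Fintype.sum_prod_type]
      exact Finset.sum_congr rfl fun i _ => Finset.sum_congr rfl fun j _ =>
        smul_mul_smul_comm _ _ _ _
  add_mem' := by
    rintro a b ha hb x
    obtain ⟨A, hA, hxA, κ, _, g, s, hg, ha⟩ := ha x
    obtain ⟨B, hB, hxB, κ', _, g', s', hg', hb⟩ := hb x
    refine ⟨A ⊓ B, inf_le_left.trans hA, ⟨hxA, hxB⟩, κ ⊕ κ', inferInstance,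
      Sum.elim g g', Sum.elim s s', fun k => ?_, fun y => ?_⟩
    · rcases k with k | k
      · exact (hg k).mono (Set.image_mono fun z hz => hz.1)
      · exact (hg' k).mono (Set.image_mono fun z hz => hz.2)
    · have e1 := ha ⟨y.1, y.2.1⟩
      have e2 := hb ⟨y.1, y.2.2⟩
      simp only at e1 e2
      rw [Pi.add_apply, e1, e2]
      simp
  algebraMap_mem' := by
    intro r x
    refine ⟨W, le_rfl, x.2, Unit, inferInstance, fun _ _ => r, fun _ => 1,
      fun _ => contDiffOn_const, fun y => ?_⟩
    simp [Algebra.algebraMap_eq_smul_one]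

/-- Restriction of sections of the structure sheaf of a graded domain. -/
def domainRes (par : ι → ZMod 2) (U : Opens (Fin N → 𝕜)) {W W' : Opens U} (h : W' ≤ W) :
    domainSections par U W →ₐ[𝕜] domainSections par U W' where
  toFun f := ⟨fun y => f.1 ⟨y.1, h y.2⟩, by
    intro x
    obtain ⟨A, hA, hxA, κ, hκ, g, s, hg, e⟩ := f.2 ⟨x.1, h x.2⟩
    exact ⟨A ⊓ W', inf_le_right, ⟨hxA, x.2⟩, κ, hκ, g, s,
      fun k => (hg k).mono (Set.image_mono fun z hz => hz.1), fun y => e ⟨y.1, y.2.1⟩⟩⟩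
  map_one' := rfl
  map_mul' _ _ := rfl
  map_zero' := rfl
  map_add' _ _ := rfl
  commutes' _ := rfl

/-- The structure presheaf of a graded domain. -/
def domainPresheaf (par : ι → ZMod 2) (U : Opens (Fin N → 𝕜)) :
    TopCat.Presheaf (AlgCat.{0} 𝕜) (TopCat.of U) where
  obj W := AlgCat.of 𝕜 (domainSections par U W.unop)
  map i := AlgCat.ofHom (domainRes par U (leOfHom i.unop))
  map_id _ := rfl
  map_comp _ _ := rfl

theorem domainPresheaf_isSheaf (par : ι → ZMod 2) (U : Opens (Fin N → 𝕜)) :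
    (domainPresheaf par U).IsSheaf := by
  rw [TopCat.Presheaf.isSheaf_iff_isSheaf_comp (forget (AlgCat.{0} 𝕜))]
  apply TopCat.Presheaf.isSheaf_of_isSheafUniqueGluing_types
  intro κ V sf hsf
  let sf' : ∀ i, domainSections par U (V i) := sf
  have hc : ∀ i j (x : U) (hi : x ∈ V i) (hj : x ∈ V j), (sf' i).1 ⟨x, hi⟩ = (sf' j).1 ⟨x, hj⟩ := by
    intro i j x hi hj
    have e : domainRes par U inf_le_left (sf' i) = domainRes par U inf_le_right (sf' j) := hsf i j
    exact congrFun (congrArg Subtype.val e) ⟨x, hi, hj⟩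
  have hex : ∀ x : (iSup V : Opens U), ∃ i, x.1 ∈ V i := fun x => Opens.mem_iSup.1 x.2
  choose c hcm using hex
  refine ⟨(⟨fun x => (sf' (c x)).1 ⟨x.1, hcm x⟩, ?_⟩ : domainSections par U (iSup V)), ?_, ?_⟩
  · intro x
    obtain ⟨A, hA, hxA, μ, hμ, g, s, hg, e⟩ := (sf' (c x)).2 ⟨x.1, hcm x⟩
    refine ⟨A, hA.trans (le_iSup V _), hxA, μ, hμ, g, s, hg, fun y => ?_⟩
    rw [← e y]
    exact hc _ _ _ _ _
  · intro i
    refine Subtype.ext (funext fun x => ?_)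
    exact hc _ _ _ _ _
  · intro t ht
    let t' : domainSections par U (iSup V) := t
    refine Subtype.ext (a1 := t') (funext fun x => ?_)
    have e : domainRes par U (le_iSup V (c x)) t' = sf' (c x) := ht (c x)
    exact congrFun (congrArg Subtype.val e) ⟨x.1, hcm x⟩

/-- The graded domain with base `U` open in `𝕜^N` and graded coordinates indexed by `ι`, of
weights `wt` and parities `par`. A section is homogeneous of weight `g` iff its values are. -/
def gradedDomain {G : Type} [AddCommGroup G] (wt : ι → G) (par : ι → ZMod 2)
    (U : Opens (Fin N → 𝕜)) : GradedSpace 𝕜 G where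
  space :=
    { carrier := TopCat.of U
      presheaf := domainPresheaf par U
      IsSheaf := domainPresheaf_isSheaf par U }
  homog W g :=
    { carrier := {f : domainSections par U W | ∀ x, f.1 x ∈ SuperSym.homog 𝕜 par wt g}
      add_mem' := fun ha hb x => Submodule.add_mem _ (ha x) (hb x)
      zero_mem' := fun _ => Submodule.zero_mem _
      smul_mem' := fun r _ ha x => Submodule.smul_mem _ r (ha x) }
  res_mem := fun h _ _ hs x => hs ⟨x.1, h x.2⟩
  local_mem := fun s hs x => by
    obtain ⟨W', h, hx, hs'⟩ := hs x.1 x.2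
    exact hs' ⟨x.1, hx⟩
  one_mem := fun W x => SuperSym.one_mem_homog par wt
  mul_mem := fun hs ht x => SuperSym.mul_mem_homog par wt (hs x) (ht x)

/-- A point of the base of a graded domain, as a point of the ringed space. -/
def toDomainPt {G : Type} [AddCommGroup G] (wt : ι → G) (par : ι → ZMod 2)
    {U : Opens (Fin N → 𝕜)} (y : U) : (gradedDomain wt par U).space := y

/-- The position in `𝕜^N` of a point of a graded domain. -/
def domainPt {G : Type} [AddCommGroup G] (wt : ι → G) (par : ι → ZMod 2)
    {U : Opens (Fin N → 𝕜)} (x : (gradedDomain wt par U).space) : Fin N → 𝕜 :=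
  (show U from x).1

/-- The base coordinate `x_i` of a graded domain, as a section over `W`. -/
def baseCoord {G : Type} [AddCommGroup G] (wt : ι → G) (par : ι → ZMod 2)
    (U : Opens (Fin N → 𝕜)) (W : Opens (gradedDomain wt par U).space) (i : Fin N) :
    (gradedDomain wt par U).space.sec W :=
  (⟨fun x => x.1.1 i • (1 : SuperSym 𝕜 par), fun x =>
    ⟨W, le_rfl, x.2, Unit, inferInstance, fun _ y => y i, fun _ => 1,
      fun _ => (contDiff_apply 𝕜 𝕜 i).contDiffOn, fun y => by simp⟩⟩ :
    domainSections par U W)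

/-- The graded coordinate of a graded domain with index `a`, as a section over `W`. -/
def gradedCoord {G : Type} [AddCommGroup G] (wt : ι → G) (par : ι → ZMod 2)
    (U : Opens (Fin N → 𝕜)) (W : Opens (gradedDomain wt par U).space) (a : ι) :
    (gradedDomain wt par U).space.sec W :=
  (⟨fun _ => SuperSym.gen 𝕜 par a, fun x =>
    ⟨W, le_rfl, x.2, Unit, inferInstance, fun _ _ => 1, fun _ => SuperSym.gen 𝕜 par a,
      fun _ => contDiffOn_const, fun y => by simp⟩⟩ :
    domainSections par U W)

end Domain

/-! ### Weight systems

A multiplicity-free weight `α_{i_1} + ⋯ + α_{i_p}` is encoded by the finite set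
`{i_1, …, i_p}`; its length is the cardinality. -/

/-- The weight in `ℤ^n` of a multiplicity-free weight. -/
def weightVec {n : ℕ} (δ : Finset (Fin n)) : Fin n → ℤ := fun i => if i ∈ δ then 1 else 0

/-- A weight in `ℤ^n` is multiplicity-free if all its coefficients are `0` or `1`. -/
def IsMultFreeWeight {n : ℕ} (γ : Fin n → ℤ) : Prop := ∀ i, γ i = 0 ∨ γ i = 1

/-- A multiplicity-free weight system: a set of multiplicity-free weights containing `0`. -/
abbrev WeightSystem (n : ℕ) : Type := {Δ : Finset (Finset (Fin n)) // ∅ ∈ Δ}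

/-- Invariance of a weight system under the permutation group. -/
def WeightSystem.Invariant {n : ℕ} (Δ : WeightSystem n) : Prop :=
  ∀ (s : Equiv.Perm (Fin n)), ∀ δ ∈ Δ.1, δ.map s.toEmbedding ∈ Δ.1

/-- The nonzero weights of `L = Δ/S_n`; the orbit of the weights of length `k` is `k`. -/
def WeightSystem.orbits {n : ℕ} (Δ : WeightSystem n) : Finset ℕ := (Δ.1.image Finset.card).erase 0

/-- Indices of the graded coordinates `ξ^k_j`, `k ∈ L \ {0}`, `j < d k`. -/
abbrev LIndex {n : ℕ} (Δ : WeightSystem n) (d : ℕ → ℕ) : Type :=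
  Σ k : {k : ℕ // k ∈ Δ.orbits}, Fin (d k)

/-- The weights of the graded coordinates `ξ^k_j`. -/
def LIndex.wt {n : ℕ} {Δ : WeightSystem n} {d : ℕ → ℕ} (a : LIndex Δ d) : ℤ := a.1.1

/-- The parities of the graded coordinates `ξ^k_j`, where `ε` is the parity of `β`. -/
def LIndex.par {n : ℕ} {Δ : WeightSystem n} {d : ℕ → ℕ} (ε : ZMod 2) (a : LIndex Δ d) : ZMod 2 :=
  (a.1.1 : ZMod 2) * ε

/-- Indices of the graded coordinates `t^δ_j`, `δ ∈ Δ \ {0}`, `j < d δ`. -/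
abbrev DIndex {n : ℕ} (Δ : WeightSystem n) (d : Finset (Fin n) → ℕ) : Type :=
  Σ δ : {δ : Finset (Fin n) // δ ∈ Δ.1 ∧ δ ≠ ∅}, Fin (d δ)

/-- The weights of the graded coordinates `t^δ_j`. -/
def DIndex.wt {n : ℕ} {Δ : WeightSystem n} {d : Finset (Fin n) → ℕ} (a : DIndex Δ d) :
    Fin n → ℤ :=
  weightVec a.1.1

/-- The parities of the graded coordinates `t^δ_j`, where `ε` is the parity of all `α_i`. -/
def DIndex.par {n : ℕ} {Δ : WeightSystem n} {d : Finset (Fin n) → ℕ} (ε : ZMod 2)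
    (a : DIndex Δ d) : ZMod 2 :=
  (a.1.1.card : ZMod 2) * ε

section

variable {𝕜 : Type} [RCLike 𝕜] {n : ℕ}

/-- The graded domain of type `L = Δ/S_n`, of dimensions `d k`, `k ∈ L`, with base `U`. -/
def LDomain (Δ : WeightSystem n) (ε : ZMod 2) (d : ℕ → ℕ) (U : Opens (Fin (d 0) → 𝕜)) :
    GradedSpace 𝕜 ℤ :=
  gradedDomain (ι := LIndex Δ d) LIndex.wt (LIndex.par ε) U

/-- The graded domain of type `Δ`, of dimensions `d δ`, `δ ∈ Δ`, with base `U`. -/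
def DDomain (Δ : WeightSystem n) (ε : ZMod 2) (d : Finset (Fin n) → ℕ)
    (U : Opens (Fin (d ∅) → 𝕜)) : GradedSpace 𝕜 (Fin n → ℤ) :=
  gradedDomain (ι := DIndex Δ d) DIndex.wt (DIndex.par ε) U

/-- The coordinates `x_i` of a graded domain of type `L`. -/
def LDomain.x (Δ : WeightSystem n) (ε : ZMod 2) (d : ℕ → ℕ) (U : Opens (Fin (d 0) → 𝕜))
    (W : Opens (LDomain Δ ε d U).space) (i : Fin (d 0)) : (LDomain Δ ε d U).space.sec W :=
  baseCoord _ _ U W i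

/-- The coordinates `ξ^k_j` of a graded domain of type `L`. -/
def LDomain.ξ (Δ : WeightSystem n) (ε : ZMod 2) (d : ℕ → ℕ) (U : Opens (Fin (d 0) → 𝕜))
    (W : Opens (LDomain Δ ε d U).space) (a : LIndex Δ d) : (LDomain Δ ε d U).space.sec W :=
  gradedCoord _ _ U W a

/-- The coordinates `y_i` of a graded domain of type `Δ`. -/
def DDomain.y (Δ : WeightSystem n) (ε : ZMod 2) (d : Finset (Fin n) → ℕ)
    (U : Opens (Fin (d ∅) → 𝕜)) (W : Opens (DDomain Δ ε d U).space) (i : Fin (d ∅)) :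
    (DDomain Δ ε d U).space.sec W :=
  baseCoord _ _ U W i

/-- The coordinates `t^δ_j` of a graded domain of type `Δ`. -/
def DDomain.t (Δ : WeightSystem n) (ε : ZMod 2) (d : Finset (Fin n) → ℕ)
    (U : Opens (Fin (d ∅) → 𝕜)) (W : Opens (DDomain Δ ε d U).space) (a : DIndex Δ d) :
    (DDomain Δ ε d U).space.sec W :=
  gradedCoord _ _ U W a

/-- The chart condition: an isomorphism, compatible with the weights, of the graded domain of type
`Δ` with base `U` onto an open part of `D`. -/
def IsChart (Δ : WeightSystem n) (ε : ZMod 2) (d : Finset (Fin n) → ℕ)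
    (D : GradedSpace 𝕜 (Fin n → ℤ)) (U : Opens (Fin (d ∅) → 𝕜))
    (e : (DDomain Δ ε d U).space ⟶ D.space) : Prop :=
  AlgebraicGeometry.SheafedSpace.IsOpenImmersion e ∧
    ∀ (W : Opens D.space), (W : Set D.space) ⊆ Set.range (RSpace.base e) →
      ∀ (γ : Fin n → ℤ) (s : D.space.sec W),
        s ∈ D.homog W γ ↔ RSpace.pull e W s ∈ (DDomain Δ ε d U).homog (RSpace.preim e W) γ

/-- A graded manifold of type `Δ`, with parity `ε` of the `α_i` and dimensions `d`. Transition
maps between charts are isomorphisms of graded ringed spaces over `𝕜`; they are automatically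
local on functions of weight `0`. -/
def IsGradedManifold (Δ : WeightSystem n) (ε : ZMod 2) (d : Finset (Fin n) → ℕ)
    (D : GradedSpace 𝕜 (Fin n → ℤ)) : Prop :=
  ∀ x : D.space, ∃ (U : Opens (Fin (d ∅) → 𝕜)) (e : (DDomain Δ ε d U).space ⟶ D.space),
    IsChart Δ ε d D U e ∧ x ∈ Set.range (RSpace.base e)

/-! ### Multiplicity-free spaces -/

/-- The relations `f = 0` for all homogeneous non-multiplicity-free sections `f` over `W`. -/
def nonMultFreeRel (D : GradedSpace 𝕜 (Fin n → ℤ)) (W : Opens D.space)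
    (a b : D.space.sec W) : Prop :=
  b = 0 ∧ ∃ γ : Fin n → ℤ, ¬ IsMultFreeWeight γ ∧ a ∈ D.homog W γ

/-- The presheaf quotient of the structure sheaf by the two-sided ideals generated by the
non-multiplicity-free sections. -/
def multFreePresheaf (D : GradedSpace 𝕜 (Fin n → ℤ)) :
    TopCat.Presheaf (AlgCat.{0} 𝕜) D.space.carrier where
  obj W := AlgCat.of 𝕜 (RingQuot (nonMultFreeRel D W.unop))
  map {W W'} i := AlgCat.ofHom (RingQuot.liftAlgHom 𝕜
    ⟨(RingQuot.mkAlgHom 𝕜 (nonMultFreeRel D W'.unop)).comp (D.space.res (leOfHom i.unop)), by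
      rintro a b ⟨rfl, γ, hγ, ha⟩
      have := RingQuot.mkAlgHom_rel 𝕜
        (s := nonMultFreeRel D W'.unop) ⟨rfl, γ, hγ, D.res_mem (leOfHom i.unop) ha⟩
      simpa using this⟩)
  map_id W := by
    apply AlgCat.hom_ext
    apply RingQuot.ringQuot_ext'
    ext a
    simp [RSpace.res]
  map_comp {A B C} i j := by
    apply AlgCat.hom_ext
    apply RingQuot.ringQuot_ext'
    ext a
    have e : D.space.res (leOfHom (i ≫ j).unop) a
        = D.space.res (leOfHom j.unop) (D.space.res (leOfHom i.unop) a) :=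
      ConcreteCategory.congr_hom (D.space.presheaf.map_comp i j) a
    simp [e]

/-- The quotient map from the structure sheaf to the presheaf quotient. -/
def toMultFreePresheaf (D : GradedSpace 𝕜 (Fin n → ℤ)) :
    D.space.presheaf ⟶ multFreePresheaf D where
  app W := AlgCat.ofHom (RingQuot.mkAlgHom 𝕜 (nonMultFreeRel D W.unop))
  naturality W W' i := by
    apply AlgCat.hom_ext
    ext a
    exact (RingQuot.liftAlgHom_mkAlgHom_apply 𝕜 _ _ a).symm

/-- The ringed space `(D₀, O_D / I_D)`, with `I_D` the sheaf of ideals locally generated by the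
non-multiplicity-free homogeneous sections. (The sheaf quotient by `I_D` is the sheafification of
the quotient by the presheaf of ideals generated by these sections.) -/
def hatSpace (D : GradedSpace 𝕜 (Fin n → ℤ)) : RSpace 𝕜 where
  carrier := D.space.carrier
  presheaf := CategoryTheory.sheafify (Opens.grothendieckTopology D.space.carrier)
    (multFreePresheaf D)
  IsSheaf := ((presheafToSheaf (Opens.grothendieckTopology D.space.carrier) (AlgCat.{0} 𝕜)).obj
    (multFreePresheaf D)).property

/-- The quotient morphism of sheaves `O_D ⟶ O_D / I_D`. -/
def hatMap (D : GradedSpace 𝕜 (Fin n → ℤ)) : D.space.presheaf ⟶ (hatSpace D).presheaf :=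
  toMultFreePresheaf D ≫ CategoryTheory.toSheafify _ _

/-- The quotient map on sections over `W`. -/
def hatSec (D : GradedSpace 𝕜 (Fin n → ℤ)) (W : Opens D.space) :
    D.space.sec W →ₐ[𝕜] (hatSpace D).sec W :=
  ((hatMap D).app (op W)).hom

/-- The canonical morphism of ringed spaces `(D₀, O_D / I_D) ⟶ D`, the identity on points. -/
def hatι (D : GradedSpace 𝕜 (Fin n → ℤ)) : hatSpace D ⟶ D.space :=
  InducedCategory.homMk
    { base := 𝟙 _
      c := { app := fun W => (hatMap D).app W
             naturality := fun _ _ i => (hatMap D).naturality i } }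

theorem res_hatSec (D : GradedSpace 𝕜 (Fin n → ℤ)) {W W' : Opens D.space} (h : W' ≤ W)
    (f : D.space.sec W) :
    (hatSpace D).res (W := W) (W' := W') h (hatSec D W f) = hatSec D W' (D.space.res h f) :=
  (ConcreteCategory.congr_hom ((hatMap D).naturality (homOfLE h).op) f).symm

theorem RSpace.res_res (X : RSpace 𝕜) {A B C : Opens X} (h : B ≤ A) (h' : C ≤ B) (s : X.sec A) :
    X.res h' (X.res h s) = X.res (h'.trans h) s :=
  (ConcreteCategory.congr_hom
    (X.presheaf.map_comp (homOfLE h).op (homOfLE h').op) s).symm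

/-- The sections of weight `γ` of `O_D / I_D`: those that are locally classes of sections of `O_D`
of weight `γ`. -/
def hatHomog (D : GradedSpace 𝕜 (Fin n → ℤ)) (W : Opens D.space) (γ : Fin n → ℤ) :
    Submodule 𝕜 ((hatSpace D).sec W) where
  carrier := {s | ∀ x ∈ W, ∃ (W' : Opens D.space) (h : W' ≤ W), x ∈ W' ∧
    ∃ f ∈ D.homog W' γ, (hatSpace D).res (W := W) (W' := W') h s = hatSec D W' f}
  add_mem' := by
    intro a b ha hb x hx
    obtain ⟨A, hA, hxA, f, hf, ea⟩ := ha x hx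
    obtain ⟨B, hB, hxB, f', hf', eb⟩ := hb x hx
    refine ⟨A ⊓ B, inf_le_left.trans hA, ⟨hxA, hxB⟩, _,
      Submodule.add_mem _ (D.res_mem inf_le_left hf) (D.res_mem inf_le_right hf'), ?_⟩
    rw [map_add, map_add, ← res_hatSec, ← res_hatSec, ← ea, ← eb]
    congr 1
    · exact (RSpace.res_res (hatSpace D) hA inf_le_left a).symm
    · exact (RSpace.res_res (hatSpace D) hB inf_le_right b).symm
  zero_mem' := fun x hx => ⟨W, le_rfl, hx, 0, Submodule.zero_mem _, by rw [map_zero, map_zero]⟩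
  smul_mem' := by
    intro r a ha x hx
    obtain ⟨A, hA, hxA, f, hf, ea⟩ := ha x hx
    exact ⟨A, hA, hxA, r • f, Submodule.smul_mem _ r hf, by rw [map_smul, map_smul, ea]⟩

/-- The multiplicity-free space `(D₀, O_D / I_D)` with its `ℤ^n`-grading. -/
def hat (D : GradedSpace 𝕜 (Fin n → ℤ)) : GradedSpace 𝕜 (Fin n → ℤ) where
  space := hatSpace D
  homog := hatHomog D
  res_mem := by
    intro W W' h γ s hs x hx
    obtain ⟨A, hA, hxA, f, hf, e⟩ := hs x (h hx)
    refine ⟨A ⊓ W', inf_le_right, ⟨hxA, hx⟩, _, D.res_mem inf_le_left hf, ?_⟩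
    rw [← res_hatSec, ← e]
    exact (RSpace.res_res (hatSpace D) h inf_le_right s).trans
      (RSpace.res_res (hatSpace D) hA inf_le_left s).symm
  local_mem := by
    intro W γ s hs x hx
    obtain ⟨W', h, hxW', hs'⟩ := hs x hx
    obtain ⟨A, hA, hxA, f, hf, e⟩ := hs' x hxW'
    exact ⟨A, hA.trans h, hxA, f, hf,
      (RSpace.res_res (hatSpace D) h hA s).symm.trans e⟩
  one_mem := fun W x hx => ⟨W, le_rfl, hx, 1, D.one_mem W, by rw [map_one, map_one]⟩
  mul_mem := by
    intro W γ γ' a b ha hb x hx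
    obtain ⟨A, hA, hxA, f, hf, ea⟩ := ha x hx
    obtain ⟨B, hB, hxB, f', hf', eb⟩ := hb x hx
    refine ⟨A ⊓ B, inf_le_left.trans hA, ⟨hxA, hxB⟩, _,
      D.mul_mem (D.res_mem inf_le_left hf) (D.res_mem inf_le_right hf'), ?_⟩
    rw [map_mul, map_mul, ← res_hatSec, ← res_hatSec, ← ea, ← eb]
    congr 1
    · exact (RSpace.res_res (hatSpace D) hA inf_le_left a).symm
    · exact (RSpace.res_res (hatSpace D) hB inf_le_right b).symm

/-- The quotient map `O_D(W) → (O_D / I_D)(W)`. -/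
def toHat (D : GradedSpace 𝕜 (Fin n → ℤ)) (W : Opens (hat D).space) :
    D.space.sec W →ₐ[𝕜] (hat D).space.sec W :=
  hatSec D W

/-- A point of `D`, as a point of the multiplicity-free space. -/
def toHatPt (D : GradedSpace 𝕜 (Fin n → ℤ)) (x : D.space) : (hat D).space := x

/-- Morphisms of multiplicity-free manifolds: the morphisms induced on the quotients by morphisms
`Φ` of graded manifolds. (The compatibility with `Φ` determines `F`.) -/
def IsMultFreeMorphism {D D' : GradedSpace 𝕜 (Fin n → ℤ)}
    (F : (hat D).space ⟶ (hat D').space) : Prop :=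
  ∃ Φ : D.space ⟶ D'.space, IsGradedMorphism (X := D) (Y := D') Φ ∧
    F ≫ hatι D' = hatι D ≫ Φ

/-- The sections of weight `k` for the `ℤ`-grading by length on a multiplicity-free space: the
sum of the homogeneous components over all multiplicity-free weights `δ` of length `k`. -/
def lengthHomog (D : GradedSpace 𝕜 (Fin n → ℤ)) (W : Opens (hat D).space) (k : ℤ) :
    Submodule 𝕜 ((hat D).space.sec W) :=
  ⨆ δ : {δ : Finset (Fin n) // (δ.card : ℤ) = k}, (hat D).homog W (weightVec δ.1)

/-- Morphisms from a multiplicity-free manifold to a graded domain of type `L`: morphisms of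
ringed spaces preserving the `ℤ`-grading, with smooth (holomorphic) underlying map. Smoothness is
expressed in charts. -/
structure IsMorphismToGraded (Δ : WeightSystem n) (ε : ZMod 2) (dM : Finset (Fin n) → ℕ)
    (D : GradedSpace 𝕜 (Fin n → ℤ)) (d : ℕ → ℕ) (U : Opens (Fin (d 0) → 𝕜))
    (ψ : (hat D).space ⟶ (LDomain Δ ε d U).space) : Prop where
  weight : ∀ (W : Opens (LDomain Δ ε d U).space) (k : ℤ) (s : (LDomain Δ ε d U).space.sec W),
    s ∈ (LDomain Δ ε d U).homog W k → RSpace.pull ψ W s ∈ lengthHomog D (RSpace.preim ψ W) k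
  smooth : ∀ x : D.space, ∃ (V : Opens (Fin (dM ∅) → 𝕜))
    (e : (DDomain Δ ε dM V).space ⟶ D.space),
    IsChart Δ ε dM D V e ∧ x ∈ Set.range (RSpace.base e) ∧
      ∃ g : (Fin (dM ∅) → 𝕜) → (Fin (d 0) → 𝕜), ContDiffOn 𝕜 ∞ g V ∧
        ∀ y : V, domainPt _ _ (RSpace.base ψ (toHatPt D (RSpace.base e (toDomainPt _ _ y)))) = g y.1

/-- The dimensions `d δ = d_{#δ}` of the multiplicity-free covering. -/
abbrev coverDim (n : ℕ) (d : ℕ → ℕ) : Finset (Fin n) → ℕ := fun δ => d δ.card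

/-- The graded domain of type `Δ` with base `U` and coordinates `t^δ_j`, `j < d #δ`; its
multiplicity-free quotient is the multiplicity-free covering of `LDomain Δ ε d U`. -/
abbrev coverDomain (Δ : WeightSystem n) (ε : ZMod 2) (d : ℕ → ℕ) (U : Opens (Fin (d 0) → 𝕜)) :
    GradedSpace 𝕜 (Fin n → ℤ) :=
  DDomain Δ ε (coverDim n d) U

/-- The index of `t^δ_j` for a weight `δ` in the orbit `k ∈ L \ {0}`. -/
def coverIndex (Δ : WeightSystem n) (d : ℕ → ℕ) (a : LIndex Δ d)
    (δ : {δ : Finset (Fin n) // δ ∈ Δ.1 ∧ δ.card = a.1.1}) : DIndex Δ (coverDim n d) :=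
  ⟨⟨δ.1, δ.2.1, fun h => (Finset.mem_erase.1 a.1.2).1
      (δ.2.2.symm.trans ((congrArg Finset.card h).trans Finset.card_empty))⟩,
    Fin.cast (congrArg d δ.2.2.symm) a.2⟩

/-- The covering morphism: `x_i ↦ y_i` and `ξ^k_j ↦ ∑_{#δ = k} t^δ_j`. -/
structure IsCovering (Δ : WeightSystem n) (ε : ZMod 2) (d : ℕ → ℕ) (U : Opens (Fin (d 0) → 𝕜))
    (p : (hat (coverDomain Δ ε d U)).space ⟶ (LDomain Δ ε d U).space) : Prop where
  morphism : IsMorphismToGraded Δ ε (coverDim n d) (coverDomain Δ ε d U) d U p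
  base_coord : ∀ i : Fin (d 0),
    RSpace.pull p ⊤ (LDomain.x Δ ε d U ⊤ i) =
      toHat (coverDomain Δ ε d U) (RSpace.preim p ⊤) (DDomain.y Δ ε (coverDim n d) U _ i)
  graded_coord : ∀ a : LIndex Δ d,
    RSpace.pull p ⊤ (LDomain.ξ Δ ε d U ⊤ a) =
      ∑ δ : {δ : Finset (Fin n) // δ ∈ Δ.1 ∧ δ.card = a.1.1},
        toHat (coverDomain Δ ε d U) (RSpace.preim p ⊤)
          (DDomain.t Δ ε (coverDim n d) U _ (coverIndex Δ d a δ))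

end

end MultFree

end

/-!
A morphism from a multiplicity-free manifold `M = (D₀, O_D / I_D)` to a graded domain is determined
by the pullbacks of the coordinates, and these pullbacks can be prescribed, subject to the weights.
The universal property of the covering `V` of `U` is a comparison of such data. A morphism
`ψ : M ⟶ U` is given by the pullbacks of the functions on the base and by sections `ψ^* ξ^k_j` of
length `k`; a morphism `Ψ : M ⟶ V` by the same pullbacks of functions and by sections
`Ψ^* t^δ_j` of weight `δ`; and `p ∘ Ψ = ψ` says that `ψ^* ξ^k_j = ∑_{#δ = k} Ψ^* t^δ_j`. So
`Ψ^* t^δ_j` has to be the component of weight `δ` of `ψ^* ξ^k_j`. Such components exist since `ψ`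
preserves the grading by length, and all of their weights belong to `Δ` since an `S_n`-invariant
set of multiplicity-free weights contains all weights of length `k` or none
(`WeightSystem.Invariant.mem_of_card`).

Three facts make this precise.

* *The ideal `I_D` has no components of multiplicity-free weight.* In a chart, multiplying by a
  coordinate of non-negative weight never turns a weight with a coefficient `≥ 2` into a
  multiplicity-free one (`SuperSym.nonMultFreeIdeal`). Hence the components of multiplicity-free
  weight are independent in `O_D / I_D` (`IsGradedManifold.hat_eq_zero_of_sum_eq_zero`), and a
  section of multiplicity-free weight of `O_D / I_D` lifts uniquely to a section of `O_D` of the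
  same weight (`IsGradedManifold.exists_lift`). The latter is what makes `Ψ` be induced by a
  morphism of graded manifolds.

* *Functions pull back by composition.* If the pullback of a function `g` under a morphism of
  ringed spaces had a value at a point other than the value `g(y)` at the image point `y`, then
  subtracting the former would give a function invertible near `y` whose pullback vanishes at the
  point (`PointEval.ev_pullTo_funSec`). Since sections of weight `0` are determined by their
  values, morphisms that agree on the coordinates agree (`domain_hom_ext`,
  `IsGradedManifold.hat_domain_hom_ext`).

* *Coordinates may be prescribed.* The structure sheaf of a graded domain is the sheafification of
  `W ↦ F(W) ⊗ S` (`tensorHom_W`), so that a morphism is obtained from compatible homomorphisms on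
  `F(W)` and on `S` with commuting values (`exists_domain_hom`,
  `IsGradedManifold.exists_gradedMorphism`). A morphism of graded manifolds then descends to the
  quotients by the ideals (`exists_hat_hom`).
-/


noncomputable section

namespace MultFree

/-! ### Sections and morphisms of ringed spaces -/

section RSpaceTools

variable {𝕜 : Type} [RCLike 𝕜] {X Y Z : RSpace 𝕜}

theorem RSpace.res_self {A : Opens X} (h : A ≤ A) (s : X.sec A) : X.res h s = s :=
  ConcreteCategory.congr_hom (X.presheaf.map_id (op A)) s

theorem RSpace.eq_of_locally_eq {W : Opens X} {s t : X.sec W}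
    (h : ∀ x ∈ W, ∃ (A : Opens X) (hA : A ≤ W), x ∈ A ∧ X.res hA s = X.res hA t) : s = t := by
  choose A hA hx e using h
  exact TopCat.Sheaf.eq_of_locally_eq' X.sheaf (fun x : W => A x.1 x.2) W
    (fun x => homOfLE (hA x.1 x.2)) (fun x hxW => Opens.mem_iSup.2 ⟨⟨x, hxW⟩, hx x hxW⟩) s t
    fun x => e x.1 x.2

theorem RSpace.exists_glue {ι : Type} {W : Opens X} (A : ι → Opens X) (hA : ∀ x, A x ≤ W)
    (hcov : ∀ x ∈ W, ∃ i, x ∈ A i) (sf : ∀ x, X.sec (A x))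
    (hc : ∀ x y, X.res (W' := A x ⊓ A y) inf_le_left (sf x) = X.res inf_le_right (sf y)) :
    ∃ s : X.sec W, ∀ x, X.res (hA x) s = sf x :=
  (TopCat.Sheaf.existsUnique_gluing' X.sheaf A W (fun x => homOfLE (hA x))
    (fun x hxW => Opens.mem_iSup.2 (hcov x hxW)) sf hc).exists

/-- The pullback of sections along `f`, followed by the restriction to an open set `A` that `f`
maps into `W`. -/
def RSpace.pullTo (f : X ⟶ Y) (W : Opens Y) (A : Opens X) (h : A ≤ RSpace.preim f W) :
    Y.sec W →ₐ[𝕜] X.sec A :=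
  (X.res h).comp (RSpace.pull f W)

theorem RSpace.pullTo_apply (f : X ⟶ Y) (W : Opens Y) (A : Opens X) (h : A ≤ RSpace.preim f W)
    (s : Y.sec W) : RSpace.pullTo f W A h s = X.res h (RSpace.pull f W s) := rfl

theorem RSpace.res_pullTo (f : X ⟶ Y) {W : Opens Y} {A B : Opens X} (h : A ≤ RSpace.preim f W)
    (hB : B ≤ A) (s : Y.sec W) :
    X.res hB (RSpace.pullTo f W A h s) = RSpace.pullTo f W B (hB.trans h) s :=
  RSpace.res_res _ _ _ _

theorem RSpace.pull_res (f : X ⟶ Y) {W W' : Opens Y} (h : W' ≤ W) (s : Y.sec W) :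
    RSpace.pull f W' (Y.res h s) =
      X.res (W := RSpace.preim f W) (fun _ hx => h hx) (RSpace.pull f W s) :=
  ConcreteCategory.congr_hom (f.hom.c.naturality (homOfLE h).op) s

theorem RSpace.pullTo_res (f : X ⟶ Y) {W W' : Opens Y} (h : W' ≤ W) {A : Opens X}
    (hA : A ≤ RSpace.preim f W') (s : Y.sec W) :
    RSpace.pullTo f W' A hA (Y.res h s) =
      RSpace.pullTo f W A (fun _ hx => h (hA hx)) s := by
  rw [pullTo_apply, pull_res]
  exact RSpace.res_res _ _ _ _

theorem RSpace.pullTo_comp (f : X ⟶ Y) (g : Y ⟶ Z) (W : Opens Z) (B : Opens Y)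
    (hB : B ≤ RSpace.preim g W) (A : Opens X) (hA : A ≤ RSpace.preim f B) (s : Z.sec W) :
    RSpace.pullTo (f ≫ g) W A (fun _ hx => hB (hA hx)) s =
      RSpace.pullTo f B A hA (RSpace.pullTo g W B hB s) := by
  rw [pullTo_apply g, pullTo_res]
  rfl

/-- Morphisms of ringed spaces agree if they agree on points and, after restriction to common
open sets, on sections. -/
theorem RSpace.hom_ext {f g : X ⟶ Y} (hb : ∀ x, RSpace.base f x = RSpace.base g x)
    (hs : ∀ (W : Opens Y) (A : Opens X) (hf : A ≤ RSpace.preim f W) (hg : A ≤ RSpace.preim g W)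
      (s : Y.sec W), RSpace.pullTo f W A hf s = RSpace.pullTo g W A hg s) : f = g := by
  obtain ⟨⟨fb, fc⟩⟩ := f
  obtain ⟨⟨gb, gc⟩⟩ := g
  have e : fb = gb := TopCat.hom_ext (ContinuousMap.ext hb)
  subst e
  congr 2
  apply NatTrans.ext
  funext W
  apply AlgCat.hom_ext
  ext s
  have := hs W.unop _ le_rfl le_rfl s
  rw [RSpace.pullTo_apply, RSpace.pullTo_apply, RSpace.res_self, RSpace.res_self] at this
  exact this

theorem RSpace.pullTo_eq_of_eq {f g : X ⟶ Y} (h : f = g) {W : Opens Y} {A : Opens X}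
    (hf : A ≤ RSpace.preim f W) (s : Y.sec W) :
    RSpace.pullTo f W A hf s = RSpace.pullTo g W A (h ▸ hf) s := by
  subst h; rfl

end RSpaceTools

/-! ### The quotient by the non-multiplicity-free sections, locally -/

section HatLocal

variable {𝕜 : Type} [RCLike 𝕜] {n : ℕ} (D : GradedSpace 𝕜 (Fin n → ℤ))

theorem hatSec_eq_toSheafify (W : Opens D.space) (f : D.space.sec W) :
    hatSec D W f = ((toSheafify (Opens.grothendieckTopology D.space.carrier)
      (multFreePresheaf D)).app (op W)).hom (RingQuot.mkAlgHom 𝕜 (nonMultFreeRel D W) f) := rfl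

/-- Sections of `O_D / I_D` lift locally to sections of `O_D`. -/
theorem exists_local_hatSec {W : Opens D.space} (s : (hatSpace D).sec W) {x : D.space}
    (hx : x ∈ W) : ∃ (A : Opens D.space) (hA : A ≤ W), x ∈ A ∧
      ∃ f : D.space.sec A, (hatSpace D).res (W := W) (W' := A) hA s = hatSec D A f := by
  have h := Presheaf.imageSieve_mem (Opens.grothendieckTopology D.space.carrier)
    (toSheafify (Opens.grothendieckTopology D.space.carrier) (multFreePresheaf D)) s
  obtain ⟨A, i, ⟨t, ht⟩, hxA⟩ := h x hx
  obtain ⟨f, hf⟩ := RingQuot.mkAlgHom_surjective 𝕜 (nonMultFreeRel D A) t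
  refine ⟨A, leOfHom i, hxA, f, ?_⟩
  rw [hatSec_eq_toSheafify, hf]
  exact ht.symm

/-- Sections with the same class in `O_D / I_D` have, locally, the same class in the presheaf
quotient. -/
theorem local_mkAlgHom_eq {W : Opens D.space} {f g : D.space.sec W}
    (e : hatSec D W f = hatSec D W g) {x : D.space}
    (hx : x ∈ W) : ∃ (A : Opens D.space) (hA : A ≤ W), x ∈ A ∧
      RingQuot.mkAlgHom 𝕜 (nonMultFreeRel D A) (D.space.res hA f) =
      RingQuot.mkAlgHom 𝕜 (nonMultFreeRel D A) (D.space.res hA g) := by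
  have h := Presheaf.equalizerSieve_mem (Opens.grothendieckTopology D.space.carrier)
    (toSheafify (Opens.grothendieckTopology D.space.carrier) (multFreePresheaf D))
    (X := op W) (RingQuot.mkAlgHom 𝕜 (nonMultFreeRel D W) f)
    (RingQuot.mkAlgHom 𝕜 (nonMultFreeRel D W) g) e
  obtain ⟨A, i, hi, hxA⟩ := h x hx
  refine ⟨A, leOfHom i, hxA, ?_⟩
  have key : ∀ f : D.space.sec W, ((multFreePresheaf D).map i.op).hom
      (RingQuot.mkAlgHom 𝕜 (nonMultFreeRel D W) f) =
      RingQuot.mkAlgHom 𝕜 (nonMultFreeRel D A) (D.space.res (leOfHom i) f) := fun f =>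
    (ConcreteCategory.congr_hom ((toMultFreePresheaf D).naturality i.op) f).symm
  exact (key f).symm.trans (hi.trans (key g))

theorem hatSec_eq_zero {W : Opens D.space} {γ : Fin n → ℤ} (hγ : ¬ IsMultFreeWeight γ)
    {f : D.space.sec W} (hf : f ∈ D.homog W γ) : hatSec D W f = 0 := by
  have e : RingQuot.mkAlgHom 𝕜 (nonMultFreeRel D W) f =
      RingQuot.mkAlgHom 𝕜 (nonMultFreeRel D W) 0 :=
    RingQuot.mkAlgHom_rel 𝕜 ⟨rfl, γ, hγ, hf⟩
  rw [hatSec_eq_toSheafify, e, ← hatSec_eq_toSheafify, map_zero]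

theorem hatSec_mem {W : Opens D.space} {γ : Fin n → ℤ} {f : D.space.sec W}
    (hf : f ∈ D.homog W γ) : hatSec D W f ∈ hatHomog D W γ :=
  fun x hx => ⟨W, le_rfl, hx, f, hf, by
    exact RSpace.res_self (X := hatSpace D) _ _⟩

end HatLocal

/-! ### The super-symmetric algebra -/

section SuperSymTools

variable {𝕜 : Type} [RCLike 𝕜] {ι : Type} {par : ι → ZMod 2}

/-- The universal property of the super-symmetric algebra. -/
def SuperSym.lift {A : Type*} [Ring A] [Algebra 𝕜 A] (f : ι → A)
    (hf : ∀ i j, f i * f j = ((-1 : 𝕜) ^ ((par i).val * (par j).val)) • (f j * f i)) :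
    SuperSym 𝕜 par →ₐ[𝕜] A :=
  RingQuot.liftAlgHom 𝕜 ⟨FreeAlgebra.lift 𝕜 f, by
    rintro _ _ ⟨i, j⟩
    simpa using hf i j⟩

@[simp]
theorem SuperSym.lift_gen {A : Type*} [Ring A] [Algebra 𝕜 A] (f : ι → A)
    (hf : ∀ i j, f i * f j = ((-1 : 𝕜) ^ ((par i).val * (par j).val)) • (f j * f i)) (i : ι) :
    SuperSym.lift f hf (SuperSym.gen 𝕜 par i) = f i := by
  simp [SuperSym.lift, SuperSym.gen]

theorem SuperSym.algHom_ext {A : Type*} [Ring A] [Algebra 𝕜 A] {f g : SuperSym 𝕜 par →ₐ[𝕜] A}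
    (h : ∀ i, f (SuperSym.gen 𝕜 par i) = g (SuperSym.gen 𝕜 par i)) : f = g := by
  apply RingQuot.ringQuot_ext'
  apply FreeAlgebra.hom_ext
  funext i
  exact h i

theorem SuperSym.gen_mul_gen (i j : ι) :
    SuperSym.gen 𝕜 par i * SuperSym.gen 𝕜 par j =
      ((-1 : 𝕜) ^ ((par i).val * (par j).val)) • (SuperSym.gen 𝕜 par j * SuperSym.gen 𝕜 par i) := by
  have := RingQuot.mkAlgHom_rel 𝕜 (SuperRel.comm (𝕜 := 𝕜) (par := par) i j)
  simpa [SuperSym.gen] using this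

theorem SuperSym.induction {p : SuperSym 𝕜 par → Prop} (algebraMap : ∀ r, p (algebraMap 𝕜 _ r))
    (gen : ∀ i, p (SuperSym.gen 𝕜 par i)) (mul : ∀ a b, p a → p b → p (a * b))
    (add : ∀ a b, p a → p b → p (a + b)) (s : SuperSym 𝕜 par) : p s := by
  obtain ⟨s, rfl⟩ := RingQuot.mkAlgHom_surjective 𝕜 (SuperRel 𝕜 par) s
  induction s using FreeAlgebra.induction with
  | grade0 r => rw [AlgHom.commutes]; exact algebraMap r
  | grade1 i => exact gen i
  | mul a b ha hb => rw [map_mul]; exact mul _ _ ha hb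
  | add a b ha hb => rw [map_add]; exact add _ _ ha hb

variable (𝕜 par) in
/-- The augmentation: all generators are sent to `0`. -/
def SuperSym.aug : SuperSym 𝕜 par →ₐ[𝕜] 𝕜 := SuperSym.lift (fun _ => 0) (by simp)

@[simp]
theorem SuperSym.aug_gen (i : ι) : SuperSym.aug 𝕜 par (SuperSym.gen 𝕜 par i) = 0 := by
  simp [SuperSym.aug]

variable {G : Type} [AddCommGroup G] (wt : ι → G)

theorem SuperSym.gen_mem_homog (i : ι) :
    SuperSym.gen 𝕜 par i ∈ SuperSym.homog 𝕜 par wt (wt i) :=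
  Submodule.subset_span ⟨[i], by simp, by simp⟩

theorem SuperSym.prod_mem_homog (l : List ι) :
    (l.map (SuperSym.gen 𝕜 par)).prod ∈ SuperSym.homog 𝕜 par wt (l.map wt).sum :=
  Submodule.subset_span ⟨l, rfl, rfl⟩

theorem SuperSym.mem_span_monomials (s : SuperSym 𝕜 par) :
    s ∈ Submodule.span 𝕜 (Set.range fun l : List ι => (l.map (SuperSym.gen 𝕜 par)).prod) := by
  induction s using SuperSym.induction with
  | algebraMap r =>
    rw [Algebra.algebraMap_eq_smul_one]
    exact Submodule.smul_mem _ _ (Submodule.subset_span ⟨[], rfl⟩)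
  | gen i => exact Submodule.subset_span ⟨[i], by simp⟩
  | add a b ha hb => exact Submodule.add_mem _ ha hb
  | mul a b ha hb =>
    have := Submodule.mul_mem_mul ha hb
    rw [Submodule.span_mul_span] at this
    refine Submodule.span_mono ?_ this
    rintro _ ⟨_, ⟨l, rfl⟩, _, ⟨l', rfl⟩, rfl⟩
    exact ⟨l ++ l', by simp⟩

theorem SuperSym.aug_eq_zero {g : G} (hg : g ≠ 0) {s : SuperSym 𝕜 par}
    (hs : s ∈ SuperSym.homog 𝕜 par wt g) : SuperSym.aug 𝕜 par s = 0 := by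
  have : SuperSym.homog 𝕜 par wt g ≤ LinearMap.ker (SuperSym.aug 𝕜 par).toLinearMap := by
    unfold SuperSym.homog
    rw [Submodule.span_le]
    rintro _ ⟨l, hl, rfl⟩
    cases l with
    | nil => exact absurd (by simpa using hl.symm) hg
    | cons a l => simp
  exact this hs

/-- A weight function is strict if only the empty product of generators has weight `0`. -/
def StrictWt (wt : ι → G) : Prop := ∀ l : List ι, (l.map wt).sum = 0 → l = []

/-- For strict weights, the elements of weight `0` are the constants. -/
theorem SuperSym.eq_aug_smul {wt : ι → G} (hw : StrictWt wt) {s : SuperSym 𝕜 par}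
    (hs : s ∈ SuperSym.homog 𝕜 par wt 0) : s = SuperSym.aug 𝕜 par s • 1 := by
  unfold SuperSym.homog at hs
  induction hs using Submodule.span_induction with
  | mem x hx =>
    obtain ⟨l, hl, rfl⟩ := hx
    rw [hw l hl]
    simp
  | zero => simp
  | add x y _ _ hx hy => rw [map_add, add_smul, ← hx, ← hy]
  | smul r x _ hx => rw [map_smul, smul_assoc, ← hx]

/-- The decomposition into homogeneous components, as an algebra homomorphism to the group
algebra of the group of weights: a generator `v` of weight `g` is sent to `v e^g`. -/
def SuperSym.grading : SuperSym 𝕜 par →ₐ[𝕜] AddMonoidAlgebra (SuperSym 𝕜 par) G :=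
  SuperSym.lift (fun i => AddMonoidAlgebra.single (wt i) (SuperSym.gen 𝕜 par i)) fun i j => by
    rw [AddMonoidAlgebra.single_mul_single, AddMonoidAlgebra.single_mul_single,
      SuperSym.gen_mul_gen, AddMonoidAlgebra.smul_single, add_comm]

/-- The projection to the component of weight `g`. -/
def SuperSym.proj (g : G) : SuperSym 𝕜 par →ₗ[𝕜] SuperSym 𝕜 par where
  toFun s := (SuperSym.grading wt s).coeff g
  map_add' s t := by simp
  map_smul' r s := by simp

theorem SuperSym.grading_of_mem {g : G} {s : SuperSym 𝕜 par}
    (hs : s ∈ SuperSym.homog 𝕜 par wt g) :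
    SuperSym.grading wt s = AddMonoidAlgebra.single g s := by
  unfold SuperSym.homog at hs
  induction hs using Submodule.span_induction with
  | mem x hx =>
    obtain ⟨l, rfl, rfl⟩ := hx
    induction l with
    | nil => simp [AddMonoidAlgebra.one_def]
    | cons a l ih =>
      rw [List.map_cons, List.prod_cons, map_mul, ih, SuperSym.grading, SuperSym.lift_gen,
        AddMonoidAlgebra.single_mul_single]
      simp
  | zero => simp
  | add x y _ _ hx hy => rw [map_add, hx, hy, AddMonoidAlgebra.single_add]
  | smul r x _ hx => rw [map_smul, hx, AddMonoidAlgebra.smul_single]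

theorem SuperSym.proj_of_mem {g : G} {s : SuperSym 𝕜 par}
    (hs : s ∈ SuperSym.homog 𝕜 par wt g) : SuperSym.proj wt g s = s := by
  simp [SuperSym.proj, SuperSym.grading_of_mem wt hs]

theorem SuperSym.proj_of_mem_ne {g h : G} (hgh : g ≠ h) {s : SuperSym 𝕜 par}
    (hs : s ∈ SuperSym.homog 𝕜 par wt g) : SuperSym.proj wt h s = 0 := by
  simp [SuperSym.proj, SuperSym.grading_of_mem wt hs, hgh]

theorem SuperSym.proj_mem (g : G) (s : SuperSym 𝕜 par) :
    SuperSym.proj wt g s ∈ SuperSym.homog 𝕜 par wt g := by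
  induction SuperSym.mem_span_monomials s using Submodule.span_induction with
  | mem x hx =>
    obtain ⟨l, rfl⟩ := hx
    by_cases h : (l.map wt).sum = g
    · subst h
      rw [SuperSym.proj_of_mem wt (SuperSym.prod_mem_homog wt l)]
      exact SuperSym.prod_mem_homog wt l
    · rw [SuperSym.proj_of_mem_ne wt h (SuperSym.prod_mem_homog wt l)]
      exact Submodule.zero_mem _
  | zero => simp
  | add x y _ _ hx hy => rw [map_add]; exact Submodule.add_mem _ hx hy
  | smul r x _ hx => rw [map_smul]; exact Submodule.smul_mem _ _ hx

theorem SuperSym.proj_gen_mul (i : ι) (g : G) (s : SuperSym 𝕜 par) :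
    SuperSym.proj wt g (SuperSym.gen 𝕜 par i * s) =
      SuperSym.gen 𝕜 par i * SuperSym.proj wt (-wt i + g) s := by
  simp [SuperSym.proj, SuperSym.grading]

theorem SuperSym.proj_mul_gen (i : ι) (g : G) (s : SuperSym 𝕜 par) :
    SuperSym.proj wt g (s * SuperSym.gen 𝕜 par i) =
      SuperSym.proj wt (g + -wt i) s * SuperSym.gen 𝕜 par i := by
  simp [SuperSym.proj, SuperSym.grading]

/-- The sign `(-1)^(ab)` is multiplicative in `a`. -/
theorem sign_add_left (a b c : ZMod 2) :
    (-1 : 𝕜) ^ ((a + b).val * c.val) = (-1) ^ (a.val * c.val) * (-1) ^ (b.val * c.val) := by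
  revert a b c
  have h : ∀ a b c : ZMod 2,
      ((a + b).val * c.val) % 2 = (a.val * c.val + b.val * c.val) % 2 := by decide
  intro a b c
  rw [← pow_add, neg_one_pow_eq_pow_mod_two, h, ← neg_one_pow_eq_pow_mod_two]

/-- Homogeneous elements supercommute, when the parities of the generators come from their
weights. -/
theorem SuperSym.mul_comm_of_mem {wt : ι → G} (p : G →+ ZMod 2) (hp : ∀ i, par i = p (wt i))
    {g h : G} {s t : SuperSym 𝕜 par}
    (hs : s ∈ SuperSym.homog 𝕜 par wt g) (ht : t ∈ SuperSym.homog 𝕜 par wt h) :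
    s * t = ((-1 : 𝕜) ^ ((p g).val * (p h).val)) • (t * s) := by
  have key1 : ∀ (i : ι) (l : List ι), (l.map (SuperSym.gen 𝕜 par)).prod * SuperSym.gen 𝕜 par i =
      ((-1 : 𝕜) ^ ((p (l.map wt).sum).val * (par i).val)) •
        (SuperSym.gen 𝕜 par i * (l.map (SuperSym.gen 𝕜 par)).prod) := by
    intro i l
    induction l with
    | nil => simp
    | cons a l ih =>
      simp only [List.map_cons, List.prod_cons, List.sum_cons, map_add]
      rw [sign_add_left, mul_assoc, ih, mul_smul_comm, ← mul_assoc, SuperSym.gen_mul_gen a i,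
        ← hp a, smul_mul_assoc, smul_smul, mul_comm, mul_assoc]
  have key2 : ∀ l l' : List ι,
      (l.map (SuperSym.gen 𝕜 par)).prod * (l'.map (SuperSym.gen 𝕜 par)).prod =
      ((-1 : 𝕜) ^ ((p (l.map wt).sum).val * (p (l'.map wt).sum).val)) •
        ((l'.map (SuperSym.gen 𝕜 par)).prod * (l.map (SuperSym.gen 𝕜 par)).prod) := by
    intro l l'
    induction l' with
    | nil => simp
    | cons a l' ih =>
      simp only [List.map_cons, List.prod_cons, List.sum_cons, map_add]
      rw [mul_comm (p _).val, sign_add_left, ← mul_assoc, key1, smul_mul_assoc, mul_assoc, ih,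
        mul_smul_comm, smul_smul, ← hp a, mul_comm (p _).val (par a).val,
        mul_comm (p _).val (p _).val, mul_assoc]
  unfold SuperSym.homog at hs ht
  induction hs using Submodule.span_induction with
  | mem x hx =>
    obtain ⟨l, rfl, rfl⟩ := hx
    induction ht using Submodule.span_induction with
    | mem y hy =>
      obtain ⟨l', rfl, rfl⟩ := hy
      exact key2 l l'
    | zero => simp
    | add x y _ _ hx hy => rw [mul_add, hx, hy, add_mul, smul_add]
    | smul r x _ hx => rw [mul_smul_comm, hx, smul_mul_assoc, smul_comm]
  | zero => simp
  | add x y _ _ hx hy => rw [add_mul, hx, hy, mul_add, smul_add]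
  | smul r x _ hx => rw [smul_mul_assoc, hx, mul_smul_comm, smul_comm]

theorem SuperSym.homog_neg_eq_zero {n : ℕ} {wt : ι → Fin n → ℤ} (hwt : ∀ i k, 0 ≤ wt i k)
    {γ : Fin n → ℤ} {k : Fin n} (hγ : γ k < 0) {s : SuperSym 𝕜 par}
    (hs : s ∈ SuperSym.homog 𝕜 par wt γ) : s = 0 := by
  have : SuperSym.homog 𝕜 par wt γ ≤ ⊥ := by
    unfold SuperSym.homog
    rw [Submodule.span_le]
    rintro _ ⟨l, rfl, rfl⟩
    exfalso
    have : ∀ l : List ι, 0 ≤ (l.map wt).sum k := by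
      intro l
      induction l with
      | nil => simp
      | cons a l ih => simpa using add_nonneg (hwt a k) ih
    exact absurd hγ (not_lt.2 (this l))
  exact (Submodule.mem_bot 𝕜).1 (this hs)

/-- The two-sided ideal of the elements without components of weight `γ` with all `γ k ≤ 1`. For
non-negative weights this is the span of the non-multiplicity-free monomials. The bound is only
from above, so that it is inherited by `γ - wt i`; weights with negative coefficients do not occur.
-/
def SuperSym.nonMultFreeIdeal {n : ℕ} (wt : ι → Fin n → ℤ) (hwt : ∀ i k, 0 ≤ wt i k) :
    TwoSidedIdeal (SuperSym 𝕜 par) :=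
  TwoSidedIdeal.mk' {s | ∀ γ : Fin n → ℤ, (∀ k, γ k ≤ 1) → SuperSym.proj wt γ s = 0}
    (fun γ _ => map_zero _)
    (fun {s t} hs ht γ hγ => by rw [map_add, hs γ hγ, ht γ hγ, add_zero])
    (fun {s} hs γ hγ => by rw [map_neg, hs γ hγ, neg_zero])
    (fun {a s} hs => by
      induction a using SuperSym.induction generalizing s with
      | algebraMap r =>
        intro γ hγ
        rw [← Algebra.smul_def, map_smul, hs γ hγ, smul_zero]
      | gen i =>
        intro γ hγ
        rw [SuperSym.proj_gen_mul, hs _ fun k => ?_, mul_zero]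
        have := hwt i k
        have := hγ k
        simp only [Pi.add_apply, Pi.neg_apply]
        omega
      | mul a b ha hb => rw [mul_assoc]; exact ha (hb hs)
      | add a b ha hb =>
        intro γ hγ
        rw [add_mul, map_add, ha hs γ hγ, hb hs γ hγ, add_zero])
    (fun {s a} hs => by
      induction a using SuperSym.induction generalizing s with
      | algebraMap r =>
        intro γ hγ
        rw [← Algebra.commutes, ← Algebra.smul_def, map_smul, hs γ hγ, smul_zero]
      | gen i =>
        intro γ hγ
        rw [SuperSym.proj_mul_gen, hs _ fun k => ?_, zero_mul]
        have := hwt i k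
        have := hγ k
        simp only [Pi.add_apply, Pi.neg_apply]
        omega
      | mul a b ha hb => rw [← mul_assoc]; exact hb (ha hs)
      | add a b ha hb =>
        intro γ hγ
        rw [mul_add, map_add, ha hs γ hγ, hb hs γ hγ, add_zero])

theorem SuperSym.mem_nonMultFreeIdeal {n : ℕ} {wt : ι → Fin n → ℤ} (hwt : ∀ i k, 0 ≤ wt i k)
    {γ : Fin n → ℤ} (hγ : ¬ IsMultFreeWeight γ) {s : SuperSym 𝕜 par}
    (hs : s ∈ SuperSym.homog 𝕜 par wt γ) : s ∈ SuperSym.nonMultFreeIdeal wt hwt := by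
  refine (TwoSidedIdeal.mem_mk' _ _ _ _ _ _ _).2 fun γ' hγ' => ?_
  by_cases h : γ = γ'
  · subst h
    obtain ⟨k, hk⟩ := not_forall.1 hγ
    have := hγ' k
    rw [SuperSym.homog_neg_eq_zero hwt (k := k) (by omega) hs, map_zero]
  · exact SuperSym.proj_of_mem_ne wt h hs

theorem SuperSym.proj_eq_zero_of_mem_nonMultFreeIdeal {n : ℕ} {wt : ι → Fin n → ℤ}
    {hwt : ∀ i k, 0 ≤ wt i k} {s : SuperSym 𝕜 par} (hs : s ∈ SuperSym.nonMultFreeIdeal wt hwt)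
    (δ : Finset (Fin n)) : SuperSym.proj wt (weightVec δ) s = 0 :=
  (TwoSidedIdeal.mem_mk' _ _ _ _ _ _ _).1 hs _ fun k => by
    unfold weightVec
    split <;> simp

/-- If a two-sided ideal contains the relations, it contains all elements that vanish in the
quotient by them. -/
theorem mem_of_mkAlgHom_eq {A : Type*} [Ring A] [Algebra 𝕜 A] {r : A → A → Prop}
    (K : TwoSidedIdeal A) (h : ∀ a b, r a b → a - b ∈ K) {a b : A}
    (e : RingQuot.mkAlgHom 𝕜 r a = RingQuot.mkAlgHom 𝕜 r b) : a - b ∈ K := by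
  have e' : RingQuot.mkRingHom r a = RingQuot.mkRingHom r b := by
    rw [← RingQuot.mkAlgHom_coe 𝕜 r]; exact e
  let L : RingQuot r →+* K.ringCon.Quotient := RingQuot.lift ⟨K.ringCon.mk', fun x y hxy =>
    (RingCon.eq _).2 ((TwoSidedIdeal.rel_iff K x y).2 (h x y hxy))⟩
  have hL : ∀ x, L (RingQuot.mkRingHom r x) = K.ringCon.mk' x := fun x =>
    RingQuot.lift_mkRingHom_apply _ _ x
  have e2 : K.ringCon.mk' a = K.ringCon.mk' b := by rw [← hL, ← hL, e']
  exact (TwoSidedIdeal.rel_iff K a b).1 ((RingCon.eq _).1 e2)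

end SuperSymTools

/-! ### Multiplicity-free weights -/

section Weights

variable {n : ℕ}

theorem weightVec_injective : Function.Injective (weightVec (n := n)) := by
  intro δ δ' h
  ext i
  have := congrFun h i
  unfold weightVec at this
  by_cases h1 : i ∈ δ <;> by_cases h2 : i ∈ δ' <;> simp_all

theorem weightVec_empty : weightVec (∅ : Finset (Fin n)) = 0 := by
  funext i; simp [weightVec]

theorem weightVec_nonneg (δ : Finset (Fin n)) (k : Fin n) : 0 ≤ weightVec δ k := by
  unfold weightVec; split <;> simp

theorem isMultFreeWeight_weightVec (δ : Finset (Fin n)) : IsMultFreeWeight (weightVec δ) := by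
  intro i; unfold weightVec; split <;> simp

theorem IsMultFreeWeight.eq_weightVec {γ : Fin n → ℤ} (h : IsMultFreeWeight γ) :
    ∃ δ, γ = weightVec δ := by
  refine ⟨Finset.univ.filter fun i => γ i = 1, funext fun i => ?_⟩
  rcases h i with h | h <;> simp [weightVec, h]

/-- The length `∑ γ_i` of a weight. -/
def weightLength (n : ℕ) : (Fin n → ℤ) →+ ℤ where
  toFun γ := ∑ i, γ i
  map_zero' := by simp
  map_add' γ γ' := by simp [Finset.sum_add_distrib]

theorem weightLength_weightVec (δ : Finset (Fin n)) : weightLength n (weightVec δ) = δ.card := by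
  simp [weightLength, weightVec]

/-- The parity of a weight, if the `α_i` have parity `ε`. -/
def weightParity (n : ℕ) (ε : ZMod 2) : (Fin n → ℤ) →+ ZMod 2 :=
  (AddMonoidHom.mulRight ε).comp ((Int.castAddHom (ZMod 2)).comp (weightLength n))

theorem DIndex.par_eq {Δ : WeightSystem n} {d : Finset (Fin n) → ℕ} (ε : ZMod 2)
    (a : DIndex Δ d) : DIndex.par ε a = weightParity n ε (DIndex.wt a) := by
  simp [DIndex.par, DIndex.wt, weightParity, weightLength_weightVec]

theorem DIndex.strictWt (Δ : WeightSystem n) (d : Finset (Fin n) → ℕ) :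
    StrictWt (DIndex.wt : DIndex Δ d → _) := by
  have h : ∀ l : List (DIndex Δ d), 0 ≤ weightLength n (l.map DIndex.wt).sum := by
    intro l
    induction l with
    | nil => simp
    | cons a l ih =>
      rw [List.map_cons, List.sum_cons, map_add, DIndex.wt, weightLength_weightVec]
      positivity
  intro l hl
  cases l with
  | nil => rfl
  | cons a l =>
    have e := congrArg (weightLength n) hl
    rw [List.map_cons, List.sum_cons, map_add, DIndex.wt, weightLength_weightVec, map_zero] at e
    have := h l
    have := Finset.card_pos.2 (Finset.nonempty_iff_ne_empty.2 a.1.2.2)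
    omega

/-- An invariant weight system contains all weights whose length it contains. -/
theorem WeightSystem.Invariant.mem_of_card {Δ : WeightSystem n} (hΔ : Δ.Invariant)
    {k : ℕ} (hk : k ∈ Δ.orbits) {δ : Finset (Fin n)} (hδ : δ.card = k) : δ ∈ Δ.1 := by
  obtain ⟨δ', hδ', e⟩ := Finset.mem_image.1 (Finset.mem_erase.1 hk).2
  let s : Equiv.Perm (Fin n) := (Finset.equivOfCardEq (e.trans hδ.symm)).extendSubtype
  have hs : δ'.map s.toEmbedding ⊆ δ := by
    intro i hi
    obtain ⟨j, hj, rfl⟩ := Finset.mem_map.1 hi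
    exact Equiv.extendSubtype_mem _ j hj
  rw [← Finset.eq_of_subset_of_card_le hs (by rw [Finset.card_map]; omega)]
  exact hΔ s δ' hδ'

end Weights

/-! ### Sections of graded domains -/

section DomainTools

open scoped TensorProduct

variable {𝕜 : Type} [RCLike 𝕜] {N : ℕ} {ι : Type}

/-- If a family of functionals separates the elements of `M`, then the induced maps `M ⊗ S → S`
separate the elements of `M ⊗ S`. -/
theorem eq_zero_of_forall_lift_eq_zero {M S W : Type*} [AddCommGroup M] [Module 𝕜 M]
    [AddCommGroup S] [Module 𝕜 S] (ev : W → M →ₗ[𝕜] 𝕜) (hev : ∀ m, (∀ y, ev y m = 0) → m = 0)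
    (z : M ⊗[𝕜] S)
    (h : ∀ y, TensorProduct.lift (LinearMap.lsmul 𝕜 S ∘ₗ ev y) z = 0) : z = 0 := by
  classical
  let b := Module.Basis.ofVectorSpace 𝕜 S
  apply (TensorProduct.equivFinsuppOfBasisRight (M := M) b).injective
  rw [map_zero]
  refine Finsupp.ext fun j => hev _ fun y => ?_
  -- Evaluation commutes with taking coordinates in a basis of `S`.
  have key : ∀ z : M ⊗[𝕜] S, ev y (TensorProduct.equivFinsuppOfBasisRight b z j) =
      b.repr (TensorProduct.lift (LinearMap.lsmul 𝕜 S ∘ₗ ev y) z) j := by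
    intro z
    induction z with
    | zero => simp
    | add z z' h h' => simp [h, h']
    | tmul m s => simp [mul_comm]
  rw [key, h]
  simp

variable {G : Type} [AddCommGroup G] (wt : ι → G) (par : ι → ZMod 2) (U : Opens (Fin N → 𝕜))

/-- The algebra of smooth (holomorphic) functions on an open part `W` of a graded domain. -/
def smoothFns (W : Opens (gradedDomain wt par U).space) : Subalgebra 𝕜 (W → 𝕜) where
  carrier := {f | ∃ g : (Fin N → 𝕜) → 𝕜,
    ContDiffOn 𝕜 ∞ g (domainPt wt par '' (W : Set (gradedDomain wt par U).space)) ∧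
    ∀ y : W, f y = g (domainPt wt par y.1)}
  mul_mem' := by
    rintro a b ⟨g, hg, e⟩ ⟨g', hg', e'⟩
    exact ⟨fun y => g y * g' y, hg.mul hg', fun y => by rw [Pi.mul_apply, e, e']⟩
  add_mem' := by
    rintro a b ⟨g, hg, e⟩ ⟨g', hg', e'⟩
    exact ⟨fun y => g y + g' y, hg.add hg', fun y => by rw [Pi.add_apply, e, e']⟩
  algebraMap_mem' r := ⟨fun _ => r, contDiffOn_const, fun _ => rfl⟩

variable {wt par U}

/-- Restriction of smooth functions. -/
def smoothRes {W W' : Opens (gradedDomain wt par U).space} (h : W' ≤ W) :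
    smoothFns wt par U W →ₐ[𝕜] smoothFns wt par U W' where
  toFun f := ⟨fun y => f.1 ⟨y.1, h y.2⟩, by
    obtain ⟨g, hg, e⟩ := f.2
    exact ⟨g, hg.mono (Set.image_mono h), fun y => e _⟩⟩
  map_one' := rfl
  map_mul' _ _ := rfl
  map_zero' := rfl
  map_add' _ _ := rfl
  commutes' _ := rfl

/-- The coordinate functions. -/
def smoothCoord (W : Opens (gradedDomain wt par U).space) (i : Fin N) : smoothFns wt par U W :=
  ⟨fun y => domainPt wt par y.1 i, fun y => y i, (contDiff_apply 𝕜 𝕜 i).contDiffOn, fun _ => rfl⟩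

/-- The value of a smooth function at a point. -/
def smoothVal {W : Opens (gradedDomain wt par U).space} (y : W) : smoothFns wt par U W →ₐ[𝕜] 𝕜 :=
  (Pi.evalAlgHom 𝕜 (fun _ : W => 𝕜) y).comp (smoothFns wt par U W).val

theorem smoothFns_ext {W : Opens (gradedDomain wt par U).space} {f g : smoothFns wt par U W}
    (h : ∀ y, smoothVal y f = smoothVal y g) : f = g :=
  Subtype.ext (funext h)

theorem isOpen_image_domainPt (W : Opens (gradedDomain wt par U).space) :
    IsOpen (domainPt wt par '' (W : Set (gradedDomain wt par U).space)) :=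
  U.isOpen.isOpenMap_subtype_val _ W.isOpen

theorem continuous_domainPt : Continuous (domainPt wt par (U := U)) :=
  continuous_subtype_val

/-- A smooth function which does not vanish at a point is invertible near that point. -/
theorem exists_smooth_inv {W : Opens (gradedDomain wt par U).space} (g : smoothFns wt par U W)
    (x : W) (hx : smoothVal x g ≠ 0) :
    ∃ (A : Opens (gradedDomain wt par U).space) (hA : A ≤ W), x.1 ∈ A ∧
      ∃ g' : smoothFns wt par U A, smoothRes hA g * g' = 1 := by
  obtain ⟨f, G, hG, e⟩ := g
  have hA := hG.continuousOn.isOpen_inter_preimage (isOpen_image_domainPt W)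
    (isOpen_compl_singleton (x := (0 : 𝕜)))
  refine ⟨⟨domainPt wt par ⁻¹'
      ((domainPt wt par '' (W : Set (gradedDomain wt par U).space)) ∩ G ⁻¹' {0}ᶜ),
    hA.preimage continuous_domainPt⟩, ?_, ?_,
    ⟨fun y => (G (domainPt wt par y.1))⁻¹, fun y => (G y)⁻¹, ?_, ?_⟩, ?_⟩
  · rintro y ⟨⟨z, hz, h⟩, -⟩
    have h' : z = y := Subtype.ext h
    rwa [← h']
  · exact ⟨⟨x.1, x.2, rfl⟩, fun h => hx ((e x).trans h)⟩
  · refine ContDiffOn.inv (hG.mono ?_) ?_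
    · rintro _ ⟨y, hy, rfl⟩
      exact hy.1
    · rintro _ ⟨y, hy, rfl⟩
      exact hy.2
  · exact fun _ => rfl
  · refine smoothFns_ext fun y => ?_
    change f _ * (G (domainPt wt par y.1))⁻¹ = 1
    rw [e]
    exact mul_inv_cancel₀ y.2.2

variable (wt par U)

/-- A smooth function, as a section of weight `0` of a graded domain. -/
def funSec (W : Opens (gradedDomain wt par U).space) :
    smoothFns wt par U W →ₐ[𝕜] (gradedDomain wt par U).space.sec W where
  toFun g := (⟨fun y => g.1 y • (1 : SuperSym 𝕜 par), fun x => by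
    obtain ⟨f, G, hG, e⟩ := g
    exact ⟨W, le_rfl, x.2, Unit, inferInstance, fun _ => G, fun _ => 1, fun _ => hG,
      fun y => by
        rw [Fintype.sum_unique]
        exact congrArg (· • (1 : SuperSym 𝕜 par)) (e y)⟩⟩ : domainSections par U W)
  map_one' := Subtype.ext (funext fun _ => one_smul _ _)
  map_mul' g g' := Subtype.ext (a1 := _) (funext fun y => by
    change (g.1 y * g'.1 y) • (1 : SuperSym 𝕜 par) = (g.1 y • 1) * (g'.1 y • 1)
    rw [smul_mul_smul_comm, one_mul])
  map_zero' := Subtype.ext (funext fun _ => zero_smul _ _)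
  map_add' g g' := Subtype.ext (funext fun _ => add_smul _ _ _)
  commutes' r := Subtype.ext (funext fun _ => (Algebra.algebraMap_eq_smul_one r).symm)

/-- An element of the super-symmetric algebra, as a constant section of a graded domain. -/
def constSec (W : Opens (gradedDomain wt par U).space) :
    SuperSym 𝕜 par →ₐ[𝕜] (gradedDomain wt par U).space.sec W where
  toFun s := (⟨fun _ => s, fun x => ⟨W, le_rfl, x.2, Unit, inferInstance, fun _ _ => 1,
    fun _ => s, fun _ => contDiffOn_const, fun y => by simp⟩⟩ : domainSections par U W)
  map_one' := rfl
  map_mul' _ _ := rfl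
  map_zero' := rfl
  map_add' _ _ := rfl
  commutes' _ := rfl

/-- The value of a section of a graded domain at a point. -/
def secVal {W : Opens (gradedDomain wt par U).space} (y : W) :
    (gradedDomain wt par U).space.sec W →ₐ[𝕜] SuperSym 𝕜 par where
  toFun s := (show domainSections par U W from s).1 y
  map_one' := rfl
  map_mul' _ _ := rfl
  map_zero' := rfl
  map_add' _ _ := rfl
  commutes' _ := rfl

variable {wt par U}

theorem secVal_funSec {W : Opens (gradedDomain wt par U).space} (y : W) (g : smoothFns wt par U W) :
    secVal wt par U y (funSec wt par U W g) = smoothVal y g • 1 := rfl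

theorem secVal_constSec {W : Opens (gradedDomain wt par U).space} (y : W) (s : SuperSym 𝕜 par) :
    secVal wt par U y (constSec wt par U W s) = s := rfl

theorem secVal_res {W W' : Opens (gradedDomain wt par U).space} (h : W' ≤ W) (y : W')
    (s : (gradedDomain wt par U).space.sec W) :
    secVal wt par U y ((gradedDomain wt par U).space.res h s) =
      secVal wt par U ⟨y.1, h y.2⟩ s := rfl

theorem sec_ext {W : Opens (gradedDomain wt par U).space}
    {s t : (gradedDomain wt par U).space.sec W}
    (h : ∀ y : W, secVal wt par U y s = secVal wt par U y t) : s = t :=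
  Subtype.ext (a1 := (show domainSections par U W from s)) (funext h)

theorem mem_homog_iff {W : Opens (gradedDomain wt par U).space} {g : G}
    {s : (gradedDomain wt par U).space.sec W} :
    s ∈ (gradedDomain wt par U).homog W g ↔
      ∀ y : W, secVal wt par U y s ∈ SuperSym.homog 𝕜 par wt g := Iff.rfl

theorem res_funSec {W W' : Opens (gradedDomain wt par U).space} (h : W' ≤ W)
    (g : smoothFns wt par U W) : (gradedDomain wt par U).space.res h (funSec wt par U W g) =
      funSec wt par U W' (smoothRes h g) := rfl

theorem res_constSec {W W' : Opens (gradedDomain wt par U).space} (h : W' ≤ W)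
    (s : SuperSym 𝕜 par) : (gradedDomain wt par U).space.res h (constSec wt par U W s) =
      constSec wt par U W' s := rfl

theorem baseCoord_eq (W : Opens (gradedDomain wt par U).space) (i : Fin N) :
    baseCoord wt par U W i = funSec wt par U W (smoothCoord W i) := rfl

theorem gradedCoord_eq (W : Opens (gradedDomain wt par U).space) (a : ι) :
    gradedCoord wt par U W a = constSec wt par U W (SuperSym.gen 𝕜 par a) := rfl

theorem funSec_mem (W : Opens (gradedDomain wt par U).space) (g : smoothFns wt par U W) :
    funSec wt par U W g ∈ (gradedDomain wt par U).homog W 0 :=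
  mem_homog_iff.2 fun _ => Submodule.smul_mem _ _ (SuperSym.one_mem_homog par wt)

theorem constSec_mem (W : Opens (gradedDomain wt par U).space) {γ : G} {s : SuperSym 𝕜 par}
    (hs : s ∈ SuperSym.homog 𝕜 par wt γ) :
    constSec wt par U W s ∈ (gradedDomain wt par U).homog W γ :=
  mem_homog_iff.2 fun _ => hs

/-- Sections of a graded domain are locally finite sums of products of functions and constants. -/
theorem exists_local_sum {W : Opens (gradedDomain wt par U).space}
    (s : (gradedDomain wt par U).space.sec W) {x : (gradedDomain wt par U).space} (hx : x ∈ W) :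
    ∃ (A : Opens (gradedDomain wt par U).space) (hA : A ≤ W), x ∈ A ∧
      ∃ (κ : Type) (_ : Fintype κ) (g : κ → smoothFns wt par U A) (c : κ → SuperSym 𝕜 par),
        (gradedDomain wt par U).space.res hA s =
          ∑ k, funSec wt par U A (g k) * constSec wt par U A (c k) := by
  obtain ⟨(A : Opens (gradedDomain wt par U).space), hA, hxA, κ, hκ, g, c, hg, e⟩ :=
    (show domainSections par U W from s).2 ⟨x, hx⟩
  refine ⟨A, hA, hxA, κ, hκ,
    fun k => ⟨fun y => g k (domainPt wt par y.1), g k, hg k, fun _ => rfl⟩, c, ?_⟩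
  refine sec_ext fun y : A => ?_
  refine (e y).trans ?_
  rw [map_sum]
  refine Finset.sum_congr rfl fun k _ => ?_
  rw [map_mul, secVal_funSec (W := A), secVal_constSec (W := A), smul_mul_assoc, one_mul]
  rfl

/-- The component of weight `γ` of a section of a graded domain. -/
def projSec (γ : G) {W : Opens (gradedDomain wt par U).space}
    (s : (gradedDomain wt par U).space.sec W) : (gradedDomain wt par U).space.sec W :=
  (⟨fun y => SuperSym.proj wt γ (secVal wt par U y s), fun x => by
    obtain ⟨A, hA, hxA, κ, hκ, g, c, hg, e⟩ := (show domainSections par U W from s).2 x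
    refine ⟨A, hA, hxA, κ, hκ, g, fun k => SuperSym.proj wt γ (c k), hg, fun y => ?_⟩
    change SuperSym.proj wt γ ((show domainSections par U W from s).1 _) = _
    rw [e y, map_sum]
    simp⟩ : domainSections par U W)

theorem secVal_projSec (γ : G) {W : Opens (gradedDomain wt par U).space}
    (s : (gradedDomain wt par U).space.sec W) (y : W) :
    secVal wt par U y (projSec γ s) = SuperSym.proj wt γ (secVal wt par U y s) := rfl

theorem projSec_mem (γ : G) {W : Opens (gradedDomain wt par U).space}
    (s : (gradedDomain wt par U).space.sec W) :
    projSec γ s ∈ (gradedDomain wt par U).homog W γ :=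
  mem_homog_iff.2 fun _ => SuperSym.proj_mem wt γ _

/-- The local form of a homogeneous section. -/
theorem exists_local_sum_of_mem {W : Opens (gradedDomain wt par U).space} {γ : G}
    {s : (gradedDomain wt par U).space.sec W} (hs : s ∈ (gradedDomain wt par U).homog W γ)
    {x : (gradedDomain wt par U).space} (hx : x ∈ W) :
    ∃ (A : Opens (gradedDomain wt par U).space) (hA : A ≤ W), x ∈ A ∧
      ∃ (κ : Type) (_ : Fintype κ) (g : κ → smoothFns wt par U A) (c : κ → SuperSym 𝕜 par),
        (∀ k, c k ∈ SuperSym.homog 𝕜 par wt γ) ∧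
        (gradedDomain wt par U).space.res hA s =
          ∑ k, funSec wt par U A (g k) * constSec wt par U A (c k) := by
  obtain ⟨A, hA, hxA, κ, hκ, g, c, e⟩ := exists_local_sum s hx
  refine ⟨A, hA, hxA, κ, hκ, g, fun k => SuperSym.proj wt γ (c k),
    fun k => SuperSym.proj_mem wt γ _, ?_⟩
  apply sec_ext
  intro y
  have h1 := congrArg (fun s => SuperSym.proj wt γ (secVal wt par U y s)) e
  simp only [secVal_res, map_sum, map_mul, secVal_funSec, secVal_constSec, smul_mul_assoc,
    one_mul, map_smul] at h1 ⊢
  rw [← h1]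
  exact (SuperSym.proj_of_mem wt (mem_homog_iff.1 hs _)).symm

/-- Sections of weight `0` are functions. -/
theorem exists_funSec (hw : StrictWt wt) {W : Opens (gradedDomain wt par U).space}
    {s : (gradedDomain wt par U).space.sec W} (hs : s ∈ (gradedDomain wt par U).homog W 0)
    {x : (gradedDomain wt par U).space} (hx : x ∈ W) :
    ∃ (A : Opens (gradedDomain wt par U).space) (hA : A ≤ W), x ∈ A ∧
      ∃ g : smoothFns wt par U A, (gradedDomain wt par U).space.res hA s = funSec wt par U A g := by
  obtain ⟨A, hA, hxA, κ, hκ, g, c, hc, e⟩ := exists_local_sum_of_mem hs hx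
  refine ⟨A, hA, hxA, ∑ k, SuperSym.aug 𝕜 par (c k) • g k, e.trans ?_⟩
  rw [map_sum]
  refine Finset.sum_congr rfl fun k _ => ?_
  rw [SuperSym.eq_aug_smul hw (hc k)]
  simp

/-- A section of weight `0` with non-zero value at a point is invertible near that point, with an
inverse of weight `0`. -/
theorem exists_inv_of_aug_ne_zero (hw : StrictWt wt) {W : Opens (gradedDomain wt par U).space}
    {s : (gradedDomain wt par U).space.sec W} (hs : s ∈ (gradedDomain wt par U).homog W 0)
    (x : W) (h : SuperSym.aug 𝕜 par (secVal wt par U x s) ≠ 0) :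
    ∃ (A : Opens (gradedDomain wt par U).space) (hA : A ≤ W), x.1 ∈ A ∧
      ∃ t ∈ (gradedDomain wt par U).homog A 0, (gradedDomain wt par U).space.res hA s * t = 1 := by
  obtain ⟨A, hA, hxA, g, e⟩ := exists_funSec hw hs x.2
  have hg : smoothVal ⟨x.1, hxA⟩ g ≠ 0 := by
    have h1 := congrArg (fun s => SuperSym.aug 𝕜 par (secVal wt par U ⟨x.1, hxA⟩ s)) e
    simp only [secVal_res, secVal_funSec, map_smul, map_one, smul_eq_mul, mul_one] at h1
    rw [← h1]
    exact h
  obtain ⟨B, hB, hxB, g', e'⟩ := exists_smooth_inv g ⟨x.1, hxA⟩ hg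
  refine ⟨B, hB.trans hA, hxB, funSec wt par U B g', funSec_mem B g', ?_⟩
  rw [← RSpace.res_res _ hA hB, e, res_funSec, ← map_mul, e', map_one]

variable (wt par U)

/-- The presheaf of tensor products `F(W) ⊗ S`, whose sheafification is the structure sheaf of a
graded domain. -/
def tensorPresheaf :
    TopCat.Presheaf (AlgCat.{0} 𝕜) (gradedDomain wt par U).space.carrier where
  obj W := AlgCat.of 𝕜 (smoothFns wt par U W.unop ⊗[𝕜] SuperSym 𝕜 par)
  map i := AlgCat.ofHom (Algebra.TensorProduct.map (smoothRes (leOfHom i.unop))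
    (AlgHom.id 𝕜 (SuperSym 𝕜 par)))
  map_id W := by
    apply AlgCat.hom_ext
    exact Algebra.TensorProduct.map_id
  map_comp i j := by
    apply AlgCat.hom_ext
    apply Algebra.TensorProduct.ext <;> rfl

/-- The map `F(W) ⊗ S → (F ⊗ S)(W)`. -/
def tensorToSec (W : Opens (gradedDomain wt par U).space) :
    smoothFns wt par U W ⊗[𝕜] SuperSym 𝕜 par →ₐ[𝕜] (gradedDomain wt par U).space.sec W :=
  Algebra.TensorProduct.lift (funSec wt par U W) (constSec wt par U W) fun g s => by
    apply sec_ext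
    intro y
    simp [secVal_funSec]

theorem tensorToSec_tmul (W : Opens (gradedDomain wt par U).space) (g : smoothFns wt par U W)
    (s : SuperSym 𝕜 par) : tensorToSec wt par U W (g ⊗ₜ s) =
      funSec wt par U W g * constSec wt par U W s :=
  Algebra.TensorProduct.lift_tmul _ _ _ _ _

theorem tensorToSec_injective (W : Opens (gradedDomain wt par U).space) :
    Function.Injective (tensorToSec wt par U W) := by
  rw [injective_iff_map_eq_zero]
  intro z hz
  have key : ∀ y : W, (secVal wt par U y).toLinearMap ∘ₗ (tensorToSec wt par U W).toLinearMap =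
      TensorProduct.lift (LinearMap.lsmul 𝕜 (SuperSym 𝕜 par) ∘ₗ (smoothVal y).toLinearMap) := by
    intro y
    refine TensorProduct.ext' fun g s => ?_
    rw [LinearMap.comp_apply, AlgHom.toLinearMap_apply, AlgHom.toLinearMap_apply,
      tensorToSec_tmul, map_mul, secVal_funSec, secVal_constSec, smul_mul_assoc, one_mul]
    rfl
  refine eq_zero_of_forall_lift_eq_zero (fun y : W => (smoothVal y).toLinearMap) (fun m hm => ?_)
    z fun y => ?_
  · refine smoothFns_ext fun y => ?_
    rw [map_zero]
    exact hm y
  · rw [← key, LinearMap.comp_apply, AlgHom.toLinearMap_apply,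
      AlgHom.toLinearMap_apply, hz, map_zero]

/-- The morphism of presheaves from `F(W) ⊗ S` to the structure sheaf. -/
def tensorHom : tensorPresheaf wt par U ⟶ (gradedDomain wt par U).space.presheaf where
  app W := AlgCat.ofHom (tensorToSec wt par U W.unop)
  naturality W W' i := by
    have hg : ∀ (A B : Opens (gradedDomain wt par U).space) (h : B ≤ A),
        (tensorToSec wt par U B).comp
          (Algebra.TensorProduct.map (smoothRes h) (AlgHom.id 𝕜 (SuperSym 𝕜 par))) =
        ((gradedDomain wt par U).space.res h).comp (tensorToSec wt par U A) := by
      intro A B h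
      apply Algebra.TensorProduct.ext
      · refine AlgHom.ext fun g => ?_
        simp [tensorToSec_tmul, res_funSec]
      · refine AlgHom.ext fun g => ?_
        simp [tensorToSec_tmul, res_constSec]
    apply AlgCat.hom_ext
    exact hg W.unop W'.unop (leOfHom i.unop)

/-- The structure sheaf of a graded domain is the sheafification of the presheaf `F(W) ⊗ S`. -/
theorem tensorHom_W :
    (Opens.grothendieckTopology (gradedDomain wt par U).space.carrier).W
      (tensorHom wt par U) := by
  rw [GrothendieckTopology.W_iff_isLocallyBijective]
  constructor
  · exact Presheaf.isLocallyInjective_of_injective _ _ fun W =>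
      tensorToSec_injective wt par U W.unop
  · constructor
    intro W s x hx
    obtain ⟨A, hA, hxA, κ, hκ, g, c, e⟩ := exists_local_sum (wt := wt) (W := W) s hx
    refine ⟨A, homOfLE hA, ⟨∑ k, g k ⊗ₜ c k, ?_⟩, hxA⟩
    refine Eq.trans ?_ e.symm
    refine (map_sum (tensorToSec wt par U A) _ _).trans ?_
    exact Finset.sum_congr rfl fun k _ => tensorToSec_tmul wt par U A _ _

end DomainTools

/-! ### Morphisms to graded domains -/

section DomainMorphisms

open scoped TensorProduct

variable {𝕜 : Type} [RCLike 𝕜] {N : ℕ} {ι : Type} {G : Type} [AddCommGroup G]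
  {wt : ι → G} {par : ι → ZMod 2} {U : Opens (Fin N → 𝕜)} {X : RSpace 𝕜}

theorem RSpace.le_preim_top {X Y : RSpace 𝕜} (f : X ⟶ Y) : (⊤ : Opens X) ≤ RSpace.preim f ⊤ :=
  fun _ _ => trivial

/-- An evaluation of sections at a point of a ringed space: compatible algebra homomorphisms from
the sections near the point to the ground field. -/
structure PointEval (X : RSpace 𝕜) (x : X) where
  ev : ∀ W : Opens X, x ∈ W → X.sec W →ₐ[𝕜] 𝕜
  ev_res : ∀ {W W' : Opens X} (h : W' ≤ W) (hx : x ∈ W') (s : X.sec W),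
    ev W' hx (X.res h s) = ev W (h hx) s

/-- Any morphism of ringed spaces pulls functions back by composition: for `c` different from the
value of `g`, the function `g - c` is invertible near the image point. -/
theorem PointEval.ev_pullTo_funSec {x : X} (E : PointEval X x)
    (f : X ⟶ (gradedDomain wt par U).space) {W : Opens (gradedDomain wt par U).space}
    {A : Opens X} (hA : A ≤ RSpace.preim f W) (hx : x ∈ A) (g : smoothFns wt par U W) :
    E.ev A hx (RSpace.pullTo f W A hA (funSec wt par U W g)) =
      smoothVal ⟨RSpace.base f x, hA hx⟩ g := by
  by_contra hne
  set c := E.ev A hx (RSpace.pullTo f W A hA (funSec wt par U W g)) with hc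
  -- `g - c` has an inverse near the image of `x`, while its pullback vanishes at `x`.
  obtain ⟨B, hB, hxB, g', e⟩ := exists_smooth_inv (g - algebraMap 𝕜 _ c)
    ⟨RSpace.base f x, hA hx⟩ (by
      rw [map_sub, AlgHom.commutes]
      exact sub_ne_zero.2 (Ne.symm hne))
  have hxA' : x ∈ A ⊓ RSpace.preim f B := ⟨hx, hxB⟩
  have e1 := congrArg (fun s => E.ev _ hxA' (RSpace.pullTo f B (A ⊓ RSpace.preim f B) inf_le_right
    (funSec wt par U B s))) e
  simp only [map_mul, map_one] at e1
  rw [← res_funSec, RSpace.pullTo_res, ← RSpace.res_pullTo f hA inf_le_left, E.ev_res, map_sub,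
    map_sub, map_sub, ← hc, AlgHom.commutes, AlgHom.commutes, AlgHom.commutes] at e1
  simp at e1

/-- Morphisms to a graded domain are determined by the pullbacks of the coordinates, provided that
the pullbacks of functions are determined by their values. -/
theorem domain_hom_ext (E : ∀ x, PointEval X x) (Z : ∀ A : Opens X, Submodule 𝕜 (X.sec A))
    (hZ : ∀ A, ∀ s ∈ Z A, (∀ x hx, (E x).ev A hx s = 0) → s = 0)
    {f g : X ⟶ (gradedDomain wt par U).space}
    (hf : ∀ (W : Opens (gradedDomain wt par U).space) (A : Opens X) (h : A ≤ RSpace.preim f W)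
      (s : smoothFns wt par U W), RSpace.pullTo f W A h (funSec wt par U W s) ∈ Z A)
    (hg : ∀ (W : Opens (gradedDomain wt par U).space) (A : Opens X) (h : A ≤ RSpace.preim g W)
      (s : smoothFns wt par U W), RSpace.pullTo g W A h (funSec wt par U W s) ∈ Z A)
    (hx : ∀ i, RSpace.pullTo f ⊤ ⊤ (RSpace.le_preim_top f) (baseCoord wt par U ⊤ i) =
      RSpace.pullTo g ⊤ ⊤ (RSpace.le_preim_top g) (baseCoord wt par U ⊤ i))
    (hξ : ∀ a, RSpace.pullTo f ⊤ ⊤ (RSpace.le_preim_top f) (gradedCoord wt par U ⊤ a) =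
      RSpace.pullTo g ⊤ ⊤ (RSpace.le_preim_top g) (gradedCoord wt par U ⊤ a)) : f = g := by
  have hb : ∀ x, RSpace.base f x = RSpace.base g x := by
    intro x
    refine Subtype.ext (a1 := (show U from RSpace.base f x)) (funext fun i => ?_)
    have e := congrArg ((E x).ev ⊤ (Opens.mem_top x)) (hx i)
    rw [baseCoord_eq, PointEval.ev_pullTo_funSec, PointEval.ev_pullTo_funSec] at e
    exact e
  refine RSpace.hom_ext hb ?_
  · intro W A hfA hgA s
    apply RSpace.eq_of_locally_eq
    intro x hxA
    obtain ⟨B, hB, hxB, κ, _, u, c, e⟩ := exists_local_sum s (hfA hxA)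
    refine ⟨A ⊓ (RSpace.preim f B ⊓ RSpace.preim g B), inf_le_left, ⟨hxA, hxB, ?_⟩, ?_⟩
    · change RSpace.base g x ∈ B
      rw [← hb]
      exact hxB
    have hfB : A ⊓ (RSpace.preim f B ⊓ RSpace.preim g B) ≤ RSpace.preim f B := fun _ h => h.2.1
    have hgB : A ⊓ (RSpace.preim f B ⊓ RSpace.preim g B) ≤ RSpace.preim g B := fun _ h => h.2.2
    rw [RSpace.res_pullTo, RSpace.res_pullTo, ← RSpace.pullTo_res f hB hfB,
      ← RSpace.pullTo_res g hB hgB, e, map_sum, map_sum]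
    refine Finset.sum_congr rfl fun k _ => ?_
    rw [map_mul, map_mul]
    congr 1
    · rw [← sub_eq_zero]
      refine hZ _ _ (Submodule.sub_mem _ (hf _ _ _ _) (hg _ _ _ _)) fun y hy => ?_
      rw [map_sub, PointEval.ev_pullTo_funSec, PointEval.ev_pullTo_funSec, sub_eq_zero]
      congr 2
      exact Subtype.ext (hb y)
    · have : (RSpace.pullTo f B _ hfB).comp (constSec wt par U B) =
          (RSpace.pullTo g B _ hgB).comp (constSec wt par U B) := by
        apply SuperSym.algHom_ext
        intro a
        have e := congrArg (X.res (W' := A ⊓ (RSpace.preim f B ⊓ RSpace.preim g B)) le_top) (hξ a)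
        rw [RSpace.res_pullTo, RSpace.res_pullTo, gradedCoord_eq,
          ← RSpace.pullTo_res f (W' := B) le_top hfB,
          ← RSpace.pullTo_res g (W' := B) le_top hgB, res_constSec] at e
        exact e
      exact DFunLike.congr_fun this (c k)

/-- Existence of morphisms to a graded domain: a morphism may be prescribed by a continuous map, a
compatible pullback of functions, and an algebra homomorphism on the super-symmetric algebra with
values that commute with the functions. -/
theorem exists_domain_hom (φ : X.carrier ⟶ (gradedDomain wt par U).space.carrier)
    (P : ∀ W : Opens (gradedDomain wt par U).space,
      smoothFns wt par U W →ₐ[𝕜] X.sec ((Opens.map φ).obj W))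
    (hP : ∀ (W W' : Opens (gradedDomain wt par U).space) (h : W' ≤ W) (g : smoothFns wt par U W),
      P W' (smoothRes h g) = X.res ((Opens.map φ).map (homOfLE h)).le (P W g))
    (σ : SuperSym 𝕜 par →ₐ[𝕜] X.sec ⊤)
    (hc : ∀ (W : Opens (gradedDomain wt par U).space) (g : smoothFns wt par U W)
      (s : SuperSym 𝕜 par), Commute (P W g) (X.res le_top (σ s))) :
    ∃ f : X ⟶ (gradedDomain wt par U).space, f.hom.base = φ ∧
      (∀ (W : Opens (gradedDomain wt par U).space) (A : Opens X) (hA : A ≤ RSpace.preim f W)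
        (hA' : A ≤ (Opens.map φ).obj W) (g : smoothFns wt par U W),
        RSpace.pullTo f W A hA (funSec wt par U W g) = X.res hA' (P W g)) ∧
      ∀ (W : Opens (gradedDomain wt par U).space) (A : Opens X) (hA : A ≤ RSpace.preim f W)
        (s : SuperSym 𝕜 par),
        RSpace.pullTo f W A hA (constSec wt par U W s) = X.res le_top (σ s) := by
  obtain ⟨T, hTt⟩ : ∃ T : ∀ W : Opens (gradedDomain wt par U).space,
      smoothFns wt par U W ⊗[𝕜] SuperSym 𝕜 par →ₐ[𝕜] X.sec ((Opens.map φ).obj W),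
      ∀ W g s, T W (g ⊗ₜ s) = P W g * X.res le_top (σ s) :=
    ⟨fun W => Algebra.TensorProduct.lift (P W) ((X.res le_top).comp σ) (hc W),
      fun W g s => Algebra.TensorProduct.lift_tmul _ _ _ _ _⟩
  have hT : ∀ (W W' : Opens (gradedDomain wt par U).space) (h : W' ≤ W),
      (T W').comp (Algebra.TensorProduct.map (smoothRes h) (AlgHom.id 𝕜 (SuperSym 𝕜 par))) =
        (X.res ((Opens.map φ).map (homOfLE h)).le).comp (T W) := by
    intro W W' h
    apply Algebra.TensorProduct.ext
    · refine AlgHom.ext fun g => ?_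
      simp [hTt, hP W W' h]
    · refine AlgHom.ext fun s => ?_
      simp [hTt, RSpace.res_res]
  let η : tensorPresheaf wt par U ⟶ (TopCat.Presheaf.pushforward _ φ).obj X.presheaf :=
    { app := fun W => AlgCat.ofHom (T W.unop)
      naturality := fun W W' i => by
        apply AlgCat.hom_ext
        exact hT W.unop W'.unop (leOfHom i.unop) }
  obtain ⟨c, hcη⟩ := (tensorHom_W wt par U ((TopCat.Presheaf.pushforward _ φ).obj X.presheaf)
    (TopCat.Sheaf.pushforward_sheaf_of_sheaf φ X.IsSheaf)).2 η
  have key : ∀ (W : Opens (gradedDomain wt par U).space)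
      (z : smoothFns wt par U W ⊗[𝕜] SuperSym 𝕜 par),
      (c.app (op W)).hom (tensorToSec wt par U W z) = T W z := fun W z =>
    ConcreteCategory.congr_hom (NatTrans.congr_app hcη (op W)) z
  refine ⟨InducedCategory.homMk { base := φ, c := c }, rfl, ?_, ?_⟩
  · intro W A hA hA' g
    have e := key W (g ⊗ₜ 1)
    rw [tensorToSec_tmul, map_one, mul_one] at e
    refine congrArg (X.res hA') (e.trans ?_)
    rw [hTt, map_one, map_one, mul_one]
  · intro W A hA s
    have e := key W (1 ⊗ₜ s)
    rw [tensorToSec_tmul, map_one, one_mul] at e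
    refine (congrArg (X.res hA) e).trans ?_
    rw [hTt, map_one, one_mul]
    exact RSpace.res_res _ _ _ _

end DomainMorphisms

/-! ### Sections of graded manifolds in charts -/

section Charts

variable {𝕜 : Type} [RCLike 𝕜] {n : ℕ} {Δ : WeightSystem n} {ε : ZMod 2}
  {d : Finset (Fin n) → ℕ} {D : GradedSpace 𝕜 (Fin n → ℤ)} {U : Opens (Fin (d ∅) → 𝕜)}
  {e : (DDomain Δ ε d U).space ⟶ D.space}

/-- The value, in a chart, of a section of a graded manifold. -/
def chartVal (e : (DDomain Δ ε d U).space ⟶ D.space) (y : (DDomain Δ ε d U).space)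
    {W : Opens D.space} (hy : RSpace.base e y ∈ W) :
    D.space.sec W →ₐ[𝕜] SuperSym 𝕜 (DIndex.par ε : DIndex Δ d → ZMod 2) :=
  (secVal DIndex.wt (DIndex.par ε) U (W := RSpace.preim e W) ⟨y, hy⟩).comp (RSpace.pull e W)

theorem chartVal_res (y : (DDomain Δ ε d U).space) {W W' : Opens D.space} (h : W' ≤ W)
    (hy : RSpace.base e y ∈ W') (s : D.space.sec W) :
    chartVal e y hy (D.space.res h s) = chartVal e y (h hy) s := by
  have := congrArg (secVal DIndex.wt (DIndex.par ε) U (W := RSpace.preim e W') ⟨y, hy⟩)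
    (RSpace.pull_res e h s)
  exact this

/-- The image of a chart. -/
def IsChart.range (he : IsChart Δ ε d D U e) : Opens D.space :=
  ⟨Set.range (RSpace.base e), he.1.base_open.isOpen_range⟩

theorem IsChart.pull_bijective (he : IsChart Δ ε d D U e) {W : Opens D.space}
    (hW : W ≤ he.range) : Function.Bijective (RSpace.pull e W) := by
  have hW' : he.1.base_open.functor.obj ((Opens.map e.hom.base).obj W) = W := by
    ext x
    constructor
    · rintro ⟨y, hy, rfl⟩
      exact hy
    · intro hx
      obtain ⟨y, rfl⟩ := hW hx
      exact ⟨y, hx, rfl⟩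
  have h := he.1.c_iso ((Opens.map e.hom.base).obj W)
  rw [hW'] at h
  exact ConcreteCategory.bijective_of_isIso (e.hom.c.app (op W))

theorem IsChart.chartVal_mem (he : IsChart Δ ε d D U e) {W : Opens D.space} {γ : Fin n → ℤ}
    {s : D.space.sec W} (hs : s ∈ D.homog W γ) (y : (DDomain Δ ε d U).space)
    (hy : RSpace.base e y ∈ W) :
    chartVal e y hy s ∈ SuperSym.homog 𝕜 (DIndex.par ε : DIndex Δ d → ZMod 2) DIndex.wt γ := by
  rw [← chartVal_res y (W' := W ⊓ he.range) inf_le_left ⟨hy, y, rfl⟩]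
  exact mem_homog_iff.1 ((he.2 (W ⊓ he.range) inf_le_right γ _).1 (D.res_mem inf_le_left hs))
    ⟨y, hy, y, rfl⟩

/-- A section of weight `0` that does not vanish at a point is invertible near that point. -/
theorem IsChart.exists_inv (he : IsChart Δ ε d D U e) {W : Opens D.space}
    {s : D.space.sec W} (hs : s ∈ D.homog W 0) (y : (DDomain Δ ε d U).space)
    (hy : RSpace.base e y ∈ W) (h : SuperSym.aug 𝕜 _ (chartVal e y hy s) ≠ 0) :
    ∃ (A : Opens D.space) (hA : A ≤ W), RSpace.base e y ∈ A ∧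
      ∃ t : D.space.sec A, D.space.res hA s * t = 1 := by
  have hs' := (he.2 (W ⊓ he.range) inf_le_right 0 _).1 (D.res_mem inf_le_left hs)
  have hy' : y ∈ RSpace.preim e (W ⊓ he.range) := ⟨hy, y, rfl⟩
  rw [← chartVal_res y (W' := W ⊓ he.range) inf_le_left ⟨hy, y, rfl⟩] at h
  obtain ⟨B, hB, hyB, t, ht⟩ : ∃ (B : Opens (DDomain Δ ε d U).space)
      (hB : B ≤ RSpace.preim e (W ⊓ he.range)), y ∈ B ∧ ∃ t : (DDomain Δ ε d U).space.sec B,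
      (DDomain Δ ε d U).space.res hB (RSpace.pull e _ (D.space.res inf_le_left s)) * t = 1 := by
    obtain ⟨B, hB, hyB, t, -, ht⟩ :=
      exists_inv_of_aug_ne_zero (DIndex.strictWt Δ d) hs' ⟨y, hy'⟩ h
    exact ⟨B, hB, hyB, t, ht⟩
  let A : Opens D.space := he.1.base_open.functor.obj B
  have hAr : A ≤ he.range := by
    rintro _ ⟨z, -, rfl⟩
    exact ⟨z, rfl⟩
  have hAW : A ≤ W ⊓ he.range := by
    rintro _ ⟨z, hz, rfl⟩
    exact hB hz
  have hAB : RSpace.preim e A ≤ B := by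
    rintro z ⟨z', hz', h⟩
    rwa [← he.1.base_open.injective h]
  obtain ⟨u, hu⟩ := (he.pull_bijective hAr).2 ((DDomain Δ ε d U).space.res hAB t)
  refine ⟨A, hAW.trans inf_le_left, ⟨y, hyB, rfl⟩, u, (he.pull_bijective hAr).1 ?_⟩
  have h2 := congrArg ((DDomain Δ ε d U).space.res hAB) ht
  rw [map_mul, map_one] at h2
  rw [map_mul, map_one, hu, ← h2, ← RSpace.res_res D.space inf_le_left hAW, RSpace.pull_res]
  congr 1

variable (hD : IsGradedManifold Δ ε d D)
include hD

/-- Sections of a graded manifold are determined by their values in charts. -/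
theorem IsGradedManifold.sec_ext {W : Opens D.space} {s t : D.space.sec W}
    (h : ∀ (U : Opens (Fin (d ∅) → 𝕜)) (e : (DDomain Δ ε d U).space ⟶ D.space),
      IsChart Δ ε d D U e → ∀ (y : (DDomain Δ ε d U).space) (hy : RSpace.base e y ∈ W),
        chartVal e y hy s = chartVal e y hy t) : s = t := by
  apply RSpace.eq_of_locally_eq
  intro x hx
  obtain ⟨U, e, he, hxe⟩ := hD x
  refine ⟨W ⊓ he.range, inf_le_left, ⟨hx, hxe⟩, (he.pull_bijective inf_le_right).1 ?_⟩
  refine MultFree.sec_ext (wt := DIndex.wt) (par := DIndex.par ε) fun y => ?_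
  have := h U e he y.1 y.2.1
  rw [← chartVal_res y.1 inf_le_left y.2, ← chartVal_res y.1 inf_le_left y.2] at this
  exact this

/-- Homogeneous sections of a graded manifold supercommute. -/
theorem IsGradedManifold.mul_comm_of_mem {W : Opens D.space} {γ γ' : Fin n → ℤ}
    {s t : D.space.sec W} (hs : s ∈ D.homog W γ) (ht : t ∈ D.homog W γ') :
    s * t = ((-1 : 𝕜) ^ ((weightParity n ε γ).val * (weightParity n ε γ').val)) • (t * s) := by
  apply hD.sec_ext
  intro U e he y hy
  rw [map_mul, map_smul, map_mul]
  exact SuperSym.mul_comm_of_mem (weightParity n ε) (DIndex.par_eq ε)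
    (he.chartVal_mem hs y hy) (he.chartVal_mem ht y hy)

/-- The ideal generated by the sections of non-multiplicity-free weight contains no non-zero sum of
sections of multiplicity-free weights: the values in a chart of its elements have no component of
multiplicity-free weight. -/
theorem IsGradedManifold.eq_zero_of_mkAlgHom_sum_eq_zero {W : Opens D.space}
    {f : Finset (Fin n) → D.space.sec W} (hf : ∀ δ, f δ ∈ D.homog W (weightVec δ))
    (h : RingQuot.mkAlgHom 𝕜 (nonMultFreeRel D W) (∑ δ, f δ) =
      RingQuot.mkAlgHom 𝕜 (nonMultFreeRel D W) 0) (δ : Finset (Fin n)) : f δ = 0 := by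
  apply hD.sec_ext
  intro U e he y hy
  have hwt : ∀ (a : DIndex Δ d) k, 0 ≤ DIndex.wt a k := fun a k => weightVec_nonneg _ k
  have h1 := mem_of_mkAlgHom_eq (𝕜 := 𝕜) (TwoSidedIdeal.comap (chartVal e y hy)
    (SuperSym.nonMultFreeIdeal DIndex.wt hwt)) (r := nonMultFreeRel D W) (by
      rintro a b ⟨rfl, γ, hγ, ha⟩
      rw [sub_zero, TwoSidedIdeal.mem_comap]
      exact SuperSym.mem_nonMultFreeIdeal hwt hγ (he.chartVal_mem ha y hy)) h
  rw [sub_zero, TwoSidedIdeal.mem_comap] at h1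
  have h2 := SuperSym.proj_eq_zero_of_mem_nonMultFreeIdeal h1 δ
  rw [map_sum, map_sum, Finset.sum_eq_single δ] at h2
  · rw [SuperSym.proj_of_mem _ (he.chartVal_mem (hf δ) y hy)] at h2
    rw [h2, map_zero]
  · intro δ' _ hne
    exact SuperSym.proj_of_mem_ne _ (fun h => hne (weightVec_injective h))
      (he.chartVal_mem (hf δ') y hy)
  · simp

/-- The multiplicity-free components of a section are not changed by passing to the quotient. -/
theorem IsGradedManifold.eq_zero_of_hatSec_sum_eq_zero {W : Opens D.space}
    {f : Finset (Fin n) → D.space.sec W} (hf : ∀ δ, f δ ∈ D.homog W (weightVec δ))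
    (h : hatSec D W (∑ δ, f δ) = 0) (δ : Finset (Fin n)) : f δ = 0 := by
  apply RSpace.eq_of_locally_eq
  intro x hx
  obtain ⟨A, hA, hxA, e⟩ := local_mkAlgHom_eq D (h.trans (map_zero _).symm) hx
  rw [map_sum, map_zero] at e
  refine ⟨A, hA, hxA, ?_⟩
  rw [map_zero]
  exact hD.eq_zero_of_mkAlgHom_sum_eq_zero (fun δ => D.res_mem hA (hf δ)) e δ

theorem IsGradedManifold.eq_zero_of_hatSec_eq_zero {W : Opens D.space} {δ : Finset (Fin n)}
    {f : D.space.sec W} (hf : f ∈ D.homog W (weightVec δ)) (h : hatSec D W f = 0) : f = 0 := by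
  classical
  have := hD.eq_zero_of_hatSec_sum_eq_zero (W := W)
    (f := fun δ' => if δ' = δ then f else 0) (fun δ' => by
      by_cases h : δ' = δ
      · subst h; simpa using hf
      · simp [h]) (by simpa using h) δ
  simpa using this

theorem IsGradedManifold.hatSec_injOn {W : Opens D.space} {δ : Finset (Fin n)}
    {f g : D.space.sec W} (hf : f ∈ D.homog W (weightVec δ)) (hg : g ∈ D.homog W (weightVec δ))
    (h : hatSec D W f = hatSec D W g) : f = g := by
  rw [← sub_eq_zero] at h ⊢
  rw [← map_sub] at h
  exact hD.eq_zero_of_hatSec_eq_zero (Submodule.sub_mem _ hf hg) h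

/-- Sections of multiplicity-free weight of the quotient lift uniquely to sections of the same
weight. -/
theorem IsGradedManifold.exists_lift {W : Opens D.space} {δ : Finset (Fin n)}
    {s : (hatSpace D).sec W} (hs : s ∈ hatHomog D W (weightVec δ)) :
    ∃ f ∈ D.homog W (weightVec δ), hatSec D W f = s := by
  choose A hA hxA f hf e using hs
  obtain ⟨g, hg⟩ := RSpace.exists_glue (X := D.space) (W := W) (ι := W) (fun x => A x.1 x.2)
    (fun x => hA x.1 x.2) (fun x hx => ⟨⟨x, hx⟩, hxA x hx⟩) (fun x => f x.1 x.2) (by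
      intro x y
      apply hD.hatSec_injOn (δ := δ) (D.res_mem _ (hf _ _)) (D.res_mem _ (hf _ _))
      rw [← res_hatSec, ← res_hatSec, ← e, ← e]
      exact (RSpace.res_res (hatSpace D) _ _ s).trans (RSpace.res_res (hatSpace D) _ _ s).symm)
  refine ⟨g, D.local_mem g fun x hx => ⟨A x hx, hA x hx, hxA x hx, ?_⟩, ?_⟩
  · rw [hg ⟨x, hx⟩]
    exact hf x hx
  · apply RSpace.eq_of_locally_eq (X := hatSpace D)
    intro x hx
    refine ⟨A x hx, hA x hx, hxA x hx, ?_⟩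
    rw [res_hatSec, hg ⟨x, hx⟩]
    exact (e x hx).symm

/-- The homogeneous components of multiplicity-free weights are independent in the quotient. -/
theorem IsGradedManifold.hat_eq_zero_of_sum_eq_zero {W : Opens D.space}
    {s : Finset (Fin n) → (hatSpace D).sec W} (hs : ∀ δ, s δ ∈ hatHomog D W (weightVec δ))
    (h : ∑ δ, s δ = 0) (δ : Finset (Fin n)) : s δ = 0 := by
  choose f hf e using fun δ => hD.exists_lift (hs δ)
  rw [← e, hD.eq_zero_of_hatSec_sum_eq_zero hf (by simpa [e] using h) δ, map_zero]

/-- The value at a point of a graded manifold, computed in some chart. -/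
def IsGradedManifold.pointEval (x : D.space) : PointEval D.space x :=
  let U := (hD x).choose
  let e : (DDomain Δ ε d U).space ⟶ D.space := (hD x).choose_spec.choose
  let y := (hD x).choose_spec.choose_spec.2.choose
  have hy : RSpace.base e y = x := (hD x).choose_spec.choose_spec.2.choose_spec
  { ev := fun _ hx => (SuperSym.aug 𝕜 _).comp (chartVal e y (by rw [hy]; exact hx))
    ev_res := fun h hx s => congrArg (SuperSym.aug 𝕜 _) (chartVal_res _ h _ s) }

theorem IsGradedManifold.pointEval_eq_zero {x : D.space} {W : Opens D.space} (hx : x ∈ W)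
    {γ : Fin n → ℤ} (hγ : γ ≠ 0) {s : D.space.sec W} (hs : s ∈ D.homog W γ) :
    (hD.pointEval x).ev W hx s = 0 :=
  SuperSym.aug_eq_zero _ hγ ((hD x).choose_spec.choose_spec.1.chartVal_mem hs _ _)

/-- The value of a section of weight `0` does not depend on the chart. -/
theorem IsGradedManifold.aug_chartVal (he : IsChart Δ ε d D U e) {W : Opens D.space}
    {s : D.space.sec W} (hs : s ∈ D.homog W 0) (y : (DDomain Δ ε d U).space)
    (hy : RSpace.base e y ∈ W) :
    SuperSym.aug 𝕜 _ (chartVal e y hy s) = (hD.pointEval _).ev W hy s := by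
  by_contra hne
  set c := (hD.pointEval _).ev W hy s with hc
  -- Otherwise `s - c` is invertible near the point, but its value in the other chart is `0`.
  have hs' : s - algebraMap 𝕜 _ c ∈ D.homog W 0 := by
    rw [Algebra.algebraMap_eq_smul_one]
    exact Submodule.sub_mem _ hs (Submodule.smul_mem _ _ (D.one_mem W))
  obtain ⟨A, hA, hyA, t, ht⟩ := he.exists_inv hs' y hy (by
    rw [map_sub, map_sub, AlgHom.commutes, AlgHom.commutes]
    exact sub_ne_zero.2 hne)
  have := congrArg ((hD.pointEval _).ev A hyA) ht
  rw [map_mul, map_one, PointEval.ev_res, map_sub, AlgHom.commutes, ← hc] at this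
  simp at this

/-- Sections of weight `0` are determined by their values. -/
theorem IsGradedManifold.eq_zero_of_pointEval {W : Opens D.space}
    {s : D.space.sec W} (hs : s ∈ D.homog W 0)
    (h : ∀ x hx, (hD.pointEval x).ev W hx s = 0) : s = 0 := by
  apply hD.sec_ext
  intro U e he y hy
  rw [map_zero, SuperSym.eq_aug_smul (DIndex.strictWt Δ d) (he.chartVal_mem hs y hy),
    hD.aug_chartVal he hs, h, zero_smul]

end Charts

/-! ### Evaluation on the multiplicity-free quotient -/

section HatEval

variable {𝕜 : Type} [RCLike 𝕜] {n : ℕ} {D : GradedSpace 𝕜 (Fin n → ℤ)}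

/-- The presheaf of all functions with values in the ground field. -/
def functionPresheaf (𝕜 : Type) [RCLike 𝕜] (X : TopCat.{0}) : TopCat.Presheaf (AlgCat.{0} 𝕜) X where
  obj W := AlgCat.of 𝕜 (W.unop → 𝕜)
  map i := AlgCat.ofHom
    { toFun := fun f y => f ⟨y.1, leOfHom i.unop y.2⟩
      map_one' := rfl
      map_mul' := fun _ _ => rfl
      map_zero' := rfl
      map_add' := fun _ _ => rfl
      commutes' := fun _ => rfl }
  map_id _ := rfl
  map_comp _ _ := rfl

theorem functionPresheaf_isSheaf (𝕜 : Type) [RCLike 𝕜] (X : TopCat.{0}) :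
    (functionPresheaf 𝕜 X).IsSheaf := by
  rw [TopCat.Presheaf.isSheaf_iff_isSheaf_comp (forget (AlgCat.{0} 𝕜))]
  exact TopCat.Presheaf.toTypes_isSheaf X fun _ => 𝕜

/-- Evaluations that vanish on sections of non-multiplicity-free weight descend to the
multiplicity-free quotient. -/
theorem exists_hat_pointEval (E : ∀ x, PointEval D.space x)
    (hE : ∀ x (W : Opens D.space) (hx : x ∈ W) (γ : Fin n → ℤ), ¬ IsMultFreeWeight γ →
      ∀ s ∈ D.homog W γ, (E x).ev W hx s = 0) :
    ∃ E' : ∀ x, PointEval (hatSpace D) x, ∀ (W : Opens D.space) x (hx : x ∈ W)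
      (s : D.space.sec W), (E' x).ev W hx (hatSec D W s) = (E x).ev W hx s := by
  let T : ∀ W : Opens D.space, D.space.sec W →ₐ[𝕜] (W → 𝕜) := fun W =>
    AlgHom.pi fun y : W => (E y.1).ev W y.2
  let T' : ∀ W : Opens D.space, RingQuot (nonMultFreeRel D W) →ₐ[𝕜] (W → 𝕜) := fun W =>
    RingQuot.liftAlgHom 𝕜 ⟨T W, by
      rintro a b ⟨rfl, γ, hγ, ha⟩
      rw [map_zero]
      exact funext fun y => hE _ _ _ γ hγ a ha⟩
  have hT' : ∀ W s, T' W (RingQuot.mkAlgHom 𝕜 _ s) = T W s := fun W s =>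
    RingQuot.liftAlgHom_mkAlgHom_apply 𝕜 _ _ s
  let η : multFreePresheaf D ⟶ functionPresheaf 𝕜 D.space.carrier :=
    { app := fun W => AlgCat.ofHom (T' W.unop)
      naturality := fun W W' i => by
        apply AlgCat.hom_ext
        apply RingQuot.ringQuot_ext'
        refine AlgHom.ext fun s => ?_
        have e1 : ((multFreePresheaf D).map i).hom (RingQuot.mkAlgHom 𝕜 _ s) =
            RingQuot.mkAlgHom 𝕜 _ (D.space.res (leOfHom i.unop) s) :=
          (ConcreteCategory.congr_hom ((toMultFreePresheaf D).naturality i) s).symm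
        refine (congrArg (T' W'.unop) e1).trans ?_
        rw [hT']
        refine Eq.trans ?_ (congrArg ((functionPresheaf 𝕜 D.space.carrier).map i).hom
          (hT' W.unop s)).symm
        exact funext fun y => PointEval.ev_res _ _ _ _ }
  let c := sheafifyLift (Opens.grothendieckTopology D.space.carrier) η
    (functionPresheaf_isSheaf 𝕜 _)
  have hc := toSheafify_sheafifyLift (Opens.grothendieckTopology D.space.carrier) η
    (functionPresheaf_isSheaf 𝕜 _)
  let C : ∀ W : Opens D.space, (hatSpace D).sec W →ₐ[𝕜] (W → 𝕜) := fun W => (c.app (op W)).hom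
  refine ⟨fun x => ⟨fun W hx => (Pi.evalAlgHom 𝕜 (fun _ : W => 𝕜) ⟨x, hx⟩).comp (C W), ?_⟩, ?_⟩
  · intro W W' h hx s
    exact congrFun (ConcreteCategory.congr_hom (c.naturality (homOfLE h).op) s) ⟨x, hx⟩
  · intro W x hx s
    have e := ConcreteCategory.congr_hom (NatTrans.congr_app hc (op W))
      (RingQuot.mkAlgHom 𝕜 (nonMultFreeRel D W) s)
    exact congrFun (e.trans (hT' W s)) ⟨x, hx⟩

/-- A multiplicity-free manifold has evaluations at its points that determine the sections of
weight `0`. -/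
theorem IsGradedManifold.exists_hat_eval {Δ : WeightSystem n} {ε : ZMod 2}
    {d : Finset (Fin n) → ℕ} (hD : IsGradedManifold Δ ε d D) :
    ∃ E : ∀ x, PointEval (hatSpace D) x, ∀ W, ∀ s ∈ hatHomog D W 0,
      (∀ x hx, (E x).ev W hx s = 0) → s = 0 := by
  obtain ⟨E, hE⟩ := exists_hat_pointEval (fun x => hD.pointEval x)
    fun x W hx γ hγ s hs => hD.pointEval_eq_zero hx (fun h => hγ (by
      rw [h]; exact fun i => Or.inl rfl)) hs
  refine ⟨E, fun W s hs h => ?_⟩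
  apply RSpace.eq_of_locally_eq (X := hatSpace D)
  intro x hx
  obtain ⟨A, hA, hxA, f, hf, e⟩ := hs x hx
  refine ⟨A, hA, hxA, ?_⟩
  rw [e, hD.eq_zero_of_pointEval hf fun z hz => ?_, map_zero, map_zero]
  rw [← hE, ← e]
  exact ((E z).ev_res (W := W) hA hz s).trans (h z _)

end HatEval

/-! ### Induced morphisms of multiplicity-free quotients -/

section HatFunctor

variable {𝕜 : Type} [RCLike 𝕜] {n : ℕ} {D D' : GradedSpace 𝕜 (Fin n → ℤ)}

theorem pullTo_hatι_comp {Y : RSpace 𝕜} (h : D.space ⟶ Y) (W : Opens Y) (A : Opens D.space)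
    (hA : A ≤ RSpace.preim h W) (s : Y.sec W) :
    RSpace.pullTo (hatι D ≫ h) W A hA s = hatSec D A (RSpace.pullTo h W A hA s) :=
  res_hatSec D hA (RSpace.pull h W s)

/-- A morphism that preserves the weights induces a morphism of the multiplicity-free quotients. -/
theorem exists_hat_hom (Φ : D.space ⟶ D'.space)
    (hΦ : ∀ (W : Opens D'.space) (γ : Fin n → ℤ) (s : D'.space.sec W), s ∈ D'.homog W γ →
      RSpace.pull Φ W s ∈ D.homog (RSpace.preim Φ W) γ) :
    ∃ Ψ : hatSpace D ⟶ hatSpace D', Ψ ≫ hatι D' = hatι D ≫ Φ := by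
  let pre : Opens D'.space → Opens D.space := fun W => RSpace.preim Φ W
  obtain ⟨F, hF⟩ : ∃ F : ∀ W : Opens D'.space, D'.space.sec W →ₐ[𝕜]
      (hatSpace D).sec (pre W),
      ∀ W s, F W s = hatSec D (pre W) (RSpace.pull Φ W s) :=
    ⟨fun W => (hatSec D (pre W)).comp (RSpace.pull Φ W), fun _ _ => rfl⟩
  have hF0 : ∀ W ⦃a b : D'.space.sec W⦄, nonMultFreeRel D' W a b → F W a = F W b := by
    intro W a b h
    obtain ⟨hb, γ, hγ, ha⟩ := h
    rw [hb, map_zero, hF]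
    exact hatSec_eq_zero D hγ (hΦ W γ a ha)
  obtain ⟨T, hT'⟩ : ∃ T : ∀ W : Opens D'.space, RingQuot (nonMultFreeRel D' W) →ₐ[𝕜]
      (hatSpace D).sec (pre W), ∀ W s, T W (RingQuot.mkAlgHom 𝕜 _ s) = F W s :=
    ⟨fun W => RingQuot.liftAlgHom 𝕜 ⟨F W, hF0 W⟩,
      fun W s => RingQuot.liftAlgHom_mkAlgHom_apply 𝕜 _ _ s⟩
  have hT : ∀ W s, T W (RingQuot.mkAlgHom 𝕜 _ s) =
      hatSec D (pre W) (RSpace.pull Φ W s) := fun W s => (hT' W s).trans (hF W s)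
  let φ : (hatSpace D).carrier ⟶ (hatSpace D').carrier := Φ.hom.base
  let η : multFreePresheaf D' ⟶ (TopCat.Presheaf.pushforward _ φ).obj (hatSpace D).presheaf :=
    { app := fun W => AlgCat.ofHom (T W.unop)
      naturality := fun W W' i => by
        apply AlgCat.hom_ext
        apply RingQuot.ringQuot_ext'
        refine AlgHom.ext fun s => ?_
        have e1 : ((multFreePresheaf D').map i).hom (RingQuot.mkAlgHom 𝕜 _ s) =
            RingQuot.mkAlgHom 𝕜 _ (D'.space.res (leOfHom i.unop) s) :=
          (ConcreteCategory.congr_hom ((toMultFreePresheaf D').naturality i) s).symm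
        refine (congrArg (T W'.unop) e1).trans ?_
        have hpre : pre W'.unop ≤ pre W.unop := fun _ hx => leOfHom i.unop hx
        refine (hT _ _).trans ?_
        refine (congrArg (hatSec D (pre W'.unop)) (RSpace.pull_res Φ (leOfHom i.unop) s)).trans ?_
        refine (res_hatSec D hpre _).symm.trans ?_
        exact congrArg ((hatSpace D).res (W := pre W.unop) (W' := pre W'.unop) hpre)
          (hT W.unop s).symm }
  let c := sheafifyLift (Opens.grothendieckTopology D'.space.carrier) η
    (TopCat.Sheaf.pushforward_sheaf_of_sheaf φ (hatSpace D).IsSheaf)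
  have hc := toSheafify_sheafifyLift (Opens.grothendieckTopology D'.space.carrier) η
    (TopCat.Sheaf.pushforward_sheaf_of_sheaf φ (hatSpace D).IsSheaf)
  refine ⟨InducedCategory.homMk { base := φ, c := c }, RSpace.hom_ext (fun x => rfl) ?_⟩
  intro W A hf hg s
  rw [RSpace.pullTo_apply, RSpace.pullTo_apply]
  congr 1
  exact (ConcreteCategory.congr_hom (NatTrans.congr_app hc (op W))
    (RingQuot.mkAlgHom 𝕜 (nonMultFreeRel D' W) s)).trans (hT W s)

/-- Morphisms to the multiplicity-free quotient are determined by their composition with the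
canonical morphism, since the quotient map of sheaves is locally surjective. -/
theorem hat_hom_ext {X : RSpace 𝕜} {f g : X ⟶ hatSpace D} (h : f ≫ hatι D = g ≫ hatι D) :
    f = g := by
  have hb : ∀ x, RSpace.base f x = RSpace.base g x := fun x =>
    congrArg (fun k : X ⟶ D.space => (RSpace.base k x : D.space)) h
  refine RSpace.hom_ext hb fun W A hf hg s => ?_
  apply RSpace.eq_of_locally_eq
  intro x hx
  obtain ⟨B, hB, hxB, t, e⟩ := exists_local_hatSec D s (hf hx)
  have hxB' : RSpace.base g x ∈ B := by rw [← hb]; exact hxB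
  have hfB : A ⊓ (RSpace.preim f B ⊓ RSpace.preim g B) ≤ RSpace.preim f B := fun _ h => h.2.1
  have hgB : A ⊓ (RSpace.preim f B ⊓ RSpace.preim g B) ≤ RSpace.preim g B := fun _ h => h.2.2
  refine ⟨A ⊓ (RSpace.preim f B ⊓ RSpace.preim g B), inf_le_left, ⟨hx, hxB, hxB'⟩, ?_⟩
  rw [RSpace.res_pullTo, RSpace.res_pullTo, ← RSpace.pullTo_res (Y := hatSpace D) f hB hfB,
    ← RSpace.pullTo_res (Y := hatSpace D) g hB hgB, e]
  exact RSpace.pullTo_eq_of_eq h (W := B) hfB t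

end HatFunctor

/-! ### Morphisms of graded domains over the identity -/

section DomainMap

variable {𝕜 : Type} [RCLike 𝕜] {N : ℕ} {ι ι' : Type} {G G' : Type} [AddCommGroup G]
  [AddCommGroup G'] (wt : ι → G) {par : ι → ZMod 2} (wt' : ι' → G') {par' : ι' → ZMod 2}
  (U : Opens (Fin N → 𝕜))

/-- The morphism of graded domains with the same base that is the identity on the base and is
given on the graded coordinates by a homomorphism of the super-symmetric algebras. -/
def domainMap (χ : SuperSym 𝕜 par →ₐ[𝕜] SuperSym 𝕜 par') :
    (gradedDomain wt' par' U).space ⟶ (gradedDomain wt par U).space :=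
  InducedCategory.homMk
    { base := 𝟙 (TopCat.of U)
      c :=
        { app := fun W => AlgCat.ofHom
            { toFun := fun f => (⟨fun y => χ ((show domainSections par U W.unop from f).1 y), by
                intro x
                obtain ⟨A, hA, hxA, κ, hκ, g, s, hg, e⟩ :=
                  (show domainSections par U W.unop from f).2 x
                exact ⟨A, hA, hxA, κ, hκ, g, fun k => χ (s k), hg, fun y => by
                  simp only [e, map_sum, map_smul]⟩⟩ : domainSections par' U W.unop)
              map_one' := Subtype.ext (funext fun _ => map_one χ)
              map_mul' := fun _ _ => Subtype.ext (funext fun _ => map_mul χ _ _)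
              map_zero' := Subtype.ext (funext fun _ => map_zero χ)
              map_add' := fun _ _ => Subtype.ext (funext fun _ => map_add χ _ _)
              commutes' := fun r => Subtype.ext (funext fun _ => χ.commutes r) }
          naturality := fun _ _ _ => rfl } }

end DomainMap

/-! ### The covering homomorphism of super-symmetric algebras -/

section CoverMap

variable {𝕜 : Type} [RCLike 𝕜] {n : ℕ} (Δ : WeightSystem n) (ε : ZMod 2) (d : ℕ → ℕ)

theorem coverIndex_par (a : LIndex Δ d) (δ : {δ : Finset (Fin n) // δ ∈ Δ.1 ∧ δ.card = a.1.1}) :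
    DIndex.par ε (coverIndex Δ d a δ) = LIndex.par ε a := by
  simp only [DIndex.par, LIndex.par, coverIndex, δ.2.2]

/-- The homomorphism `ξ^k_j ↦ ∑ t^δ_j` of super-symmetric algebras. -/
def coverAlgHom : SuperSym 𝕜 (LIndex.par ε : LIndex Δ d → ZMod 2) →ₐ[𝕜]
    SuperSym 𝕜 (DIndex.par ε : DIndex Δ (coverDim n d) → ZMod 2) :=
  SuperSym.lift (fun a => ∑ δ, SuperSym.gen 𝕜 _ (coverIndex Δ d a δ)) fun a b => by
    rw [Finset.sum_mul_sum, Finset.sum_mul_sum, Finset.smul_sum, Finset.sum_comm]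
    refine Finset.sum_congr rfl fun δ _ => ?_
    rw [Finset.smul_sum]
    refine Finset.sum_congr rfl fun δ' _ => ?_
    rw [SuperSym.gen_mul_gen, coverIndex_par, coverIndex_par]

theorem coverAlgHom_gen (a : LIndex Δ d) :
    coverAlgHom (𝕜 := 𝕜) Δ ε d (SuperSym.gen 𝕜 _ a) =
      ∑ δ, SuperSym.gen 𝕜 _ (coverIndex Δ d a δ) :=
  SuperSym.lift_gen _ _ _

/-- The homomorphism preserves the length. -/
theorem coverAlgHom_mem {k : ℤ} {s : SuperSym 𝕜 (LIndex.par ε : LIndex Δ d → ZMod 2)}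
    (hs : s ∈ SuperSym.homog 𝕜 _ LIndex.wt k) : coverAlgHom Δ ε d s ∈
      SuperSym.homog 𝕜 _ (fun a : DIndex Δ (coverDim n d) => weightLength n (DIndex.wt a)) k := by
  unfold SuperSym.homog at hs
  induction hs using Submodule.span_induction with
  | mem x hx =>
    obtain ⟨l, rfl, rfl⟩ := hx
    induction l with
    | nil => simpa using SuperSym.one_mem_homog _ _
    | cons a l ih =>
      rw [List.map_cons, List.map_cons, List.prod_cons, List.sum_cons, map_mul]
      refine SuperSym.mul_mem_homog _ _ ?_ ih
      rw [coverAlgHom_gen]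
      refine Submodule.sum_mem _ fun δ _ => ?_
      have := SuperSym.gen_mem_homog (𝕜 := 𝕜) (par := DIndex.par ε)
        (fun a : DIndex Δ (coverDim n d) => weightLength n (DIndex.wt a)) (coverIndex Δ d a δ)
      rw [DIndex.wt, weightLength_weightVec] at this
      simpa [LIndex.wt, coverIndex, δ.2.2] using this
  | zero => simp
  | add x y _ _ hx hy => rw [map_add]; exact Submodule.add_mem _ hx hy
  | smul r x _ hx => rw [map_smul]; exact Submodule.smul_mem _ _ hx

theorem proj_coverAlgHom {k : ℤ} {s : SuperSym 𝕜 (LIndex.par ε : LIndex Δ d → ZMod 2)}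
    (hs : s ∈ SuperSym.homog 𝕜 _ LIndex.wt k) {γ : Fin n → ℤ} (hγ : weightLength n γ ≠ k) :
    SuperSym.proj DIndex.wt γ (coverAlgHom Δ ε d s) = 0 := by
  have h1 := coverAlgHom_mem Δ ε d hs
  generalize coverAlgHom Δ ε d s = u at h1
  unfold SuperSym.homog at h1
  induction h1 using Submodule.span_induction with
  | mem x hx =>
    obtain ⟨l, hl, rfl⟩ := hx
    refine SuperSym.proj_of_mem_ne _ (fun h => hγ ?_) (SuperSym.prod_mem_homog _ l)
    rw [← h, ← hl, map_list_sum, List.map_map]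
    rfl
  | zero => simp
  | add x y _ _ hx hy => rw [map_add, hx, hy, add_zero]
  | smul r x _ hx => rw [map_smul, hx, smul_zero]

end CoverMap

/-! ### Multiplicity-free components of sections of graded domains -/

section Components

variable {𝕜 : Type} [RCLike 𝕜] {N : ℕ} {ι : Type} {G : Type} [AddCommGroup G]
  {wt : ι → G} {par : ι → ZMod 2} {U : Opens (Fin N → 𝕜)}

theorem projSec_sum (γ : G) {A : Opens (gradedDomain wt par U).space} {κ : Type} [Fintype κ]
    (g : κ → smoothFns wt par U A) (c : κ → SuperSym 𝕜 par) :
    projSec γ (∑ k, funSec wt par U A (g k) * constSec wt par U A (c k)) =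
      ∑ k, funSec wt par U A (g k) * constSec wt par U A (SuperSym.proj wt γ (c k)) := by
  apply sec_ext
  intro y
  simp only [secVal_projSec, map_sum, map_mul, secVal_funSec, secVal_constSec, smul_mul_assoc,
    one_mul, map_smul]

/-- A homomorphism that kills the sections of non-multiplicity-free weight only sees the
multiplicity-free components of a section. -/
theorem algHom_eq_sum_projSec {n : ℕ} {wt : ι → Fin n → ℤ}
    {A : Opens (gradedDomain wt par U).space} {B : Type*} [Ring B] [Algebra 𝕜 B]
    (H : (gradedDomain wt par U).space.sec A →ₐ[𝕜] B)
    (hH : ∀ γ : Fin n → ℤ, ¬ IsMultFreeWeight γ → ∀ s ∈ (gradedDomain wt par U).homog A γ, H s = 0)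
    {κ : Type} [Fintype κ] (g : κ → smoothFns wt par U A) (c : κ → SuperSym 𝕜 par) :
    H (∑ k, funSec wt par U A (g k) * constSec wt par U A (c k)) =
      ∑ δ : Finset (Fin n), H (projSec (weightVec δ)
        (∑ k, funSec wt par U A (g k) * constSec wt par U A (c k))) := by
  have key : ∀ c : SuperSym 𝕜 par, H (constSec wt par U A c) =
      ∑ δ : Finset (Fin n), H (constSec wt par U A (SuperSym.proj wt (weightVec δ) c)) := by
    intro c
    induction SuperSym.mem_span_monomials c using Submodule.span_induction with
    | mem x hx =>
      obtain ⟨l, rfl⟩ := hx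
      have hl := SuperSym.prod_mem_homog (𝕜 := 𝕜) (par := par) wt l
      by_cases h : IsMultFreeWeight (l.map wt).sum
      · obtain ⟨δ, hδ⟩ := h.eq_weightVec
        rw [hδ] at hl
        rw [Finset.sum_eq_single δ]
        · rw [SuperSym.proj_of_mem _ hl]
        · intro δ' _ hne
          rw [SuperSym.proj_of_mem_ne _ (fun h => hne (weightVec_injective h).symm) hl, map_zero,
            map_zero]
        · simp
      · rw [hH _ h _ (constSec_mem A hl)]
        symm
        refine Finset.sum_eq_zero fun δ _ => ?_
        rw [SuperSym.proj_of_mem_ne _ (fun e => h (by rw [e]; exact isMultFreeWeight_weightVec δ))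
          hl, map_zero, map_zero]
    | zero => simp
    | add x y _ _ hx hy => simp only [map_add, Finset.sum_add_distrib, hx, hy]
    | smul r x _ hx => simp only [map_smul, hx, Finset.smul_sum]
  simp only [projSec_sum, map_sum, map_mul]
  rw [Finset.sum_comm]
  refine Finset.sum_congr rfl fun k _ => ?_
  rw [key, Finset.mul_sum]

/-- In the multiplicity-free quotient of a graded domain, a section is the sum of its components
of multiplicity-free weight. -/
theorem hatSec_eq_sum_projSec {n : ℕ} {wt : ι → Fin n → ℤ}
    {W : Opens (gradedDomain wt par U).space} (s : (gradedDomain wt par U).space.sec W) :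
    hatSec (gradedDomain wt par U) W s =
      ∑ δ : Finset (Fin n), hatSec (gradedDomain wt par U) W (projSec (weightVec δ) s) := by
  rw [← map_sum]
  apply RSpace.eq_of_locally_eq (X := hatSpace (gradedDomain wt par U))
  intro x hx
  obtain ⟨A, hA, hxA, κ, hκ, g, c, e⟩ := exists_local_sum s hx
  refine ⟨A, hA, hxA, ?_⟩
  have e' : ∀ γ, (gradedDomain wt par U).space.res hA (projSec γ s) = projSec γ
      (∑ k, funSec wt par U A (g k) * constSec wt par U A (c k)) := fun γ =>
    congrArg (projSec γ) e
  rw [res_hatSec, res_hatSec, map_sum, e]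
  simp only [e', map_sum (hatSec (gradedDomain wt par U) A)]
  refine Eq.trans ?_ (algHom_eq_sum_projSec (hatSec (gradedDomain wt par U) A)
    (fun γ hγ s hs => hatSec_eq_zero _ hγ hs) g c)
  rw [map_sum]

end Components

/-! ### The covering morphism -/

section Covering

variable {𝕜 : Type} [RCLike 𝕜] {n : ℕ} (Δ : WeightSystem n) (ε : ZMod 2)

theorem isChart_id (d : Finset (Fin n) → ℕ) (U : Opens (Fin (d ∅) → 𝕜)) :
    IsChart Δ ε d (DDomain Δ ε d U) U (𝟙 _) :=
  ⟨inferInstance, fun _ _ _ _ => Iff.rfl⟩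

theorem isGradedManifold_domain (d : Finset (Fin n) → ℕ) (U : Opens (Fin (d ∅) → 𝕜)) :
    IsGradedManifold Δ ε d (DDomain Δ ε d U) :=
  fun x => ⟨U, 𝟙 _, isChart_id Δ ε d U, x, rfl⟩

variable (d : ℕ → ℕ) (U : Opens (Fin (d 0) → 𝕜))

/-- The morphism of graded domains `x_i ↦ y_i`, `ξ^k_j ↦ ∑ t^δ_j`. -/
def coverMap : (coverDomain Δ ε d U).space ⟶ (LDomain Δ ε d U).space :=
  domainMap LIndex.wt DIndex.wt U (coverAlgHom Δ ε d)

theorem pull_coverMap_x (W : Opens (LDomain Δ ε d U).space) (i : Fin (d 0)) :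
    RSpace.pull (coverMap Δ ε d U) W (LDomain.x Δ ε d U W i) =
      DDomain.y Δ ε (coverDim n d) U (RSpace.preim (coverMap Δ ε d U) W) i := by
  refine sec_ext (wt := DIndex.wt) (par := DIndex.par ε) fun y => ?_
  exact (map_smul (coverAlgHom Δ ε d) _ _).trans (congrArg _ (map_one _))

theorem pull_coverMap_ξ (W : Opens (LDomain Δ ε d U).space) (a : LIndex Δ d) :
    RSpace.pull (coverMap Δ ε d U) W (LDomain.ξ Δ ε d U W a) =
      ∑ δ, DDomain.t Δ ε (coverDim n d) U (RSpace.preim (coverMap Δ ε d U) W)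
        (coverIndex Δ d a δ) := by
  refine sec_ext (wt := DIndex.wt) (par := DIndex.par ε) fun y => ?_
  refine (coverAlgHom_gen Δ ε d a).trans ?_
  exact (map_sum (secVal DIndex.wt (DIndex.par ε) U y) (fun δ => DDomain.t Δ ε (coverDim n d) U
    (RSpace.preim (coverMap Δ ε d U) W) (coverIndex Δ d a δ)) Finset.univ).symm

/-- A smooth function, as a function on the covering domain. -/
def smoothFnsCover (W : Opens (LDomain Δ ε d U).space) :
    smoothFns (LIndex.wt : LIndex Δ d → ℤ) (LIndex.par ε) U W ≃ₐ[𝕜]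
      smoothFns (DIndex.wt : DIndex Δ (coverDim n d) → _) (DIndex.par ε) U W where
  toFun g := ⟨g.1, g.2⟩
  invFun g := ⟨g.1, g.2⟩
  left_inv _ := rfl
  right_inv _ := rfl
  map_mul' _ _ := rfl
  map_add' _ _ := rfl
  commutes' _ := rfl

/-- The covering morphism from the multiplicity-free domain. -/
def coverHom : (hat (coverDomain Δ ε d U)).space ⟶ (LDomain Δ ε d U).space :=
  hatι (coverDomain Δ ε d U) ≫ coverMap Δ ε d U

theorem pull_coverHom (W : Opens (LDomain Δ ε d U).space) (s : (LDomain Δ ε d U).space.sec W) :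
    RSpace.pull (coverHom Δ ε d U) W s = hatSec (coverDomain Δ ε d U)
      (RSpace.preim (coverMap Δ ε d U) W) (RSpace.pull (coverMap Δ ε d U) W s) := rfl

theorem projSec_pull_coverMap (W : Opens (LDomain Δ ε d U).space) {k : ℤ}
    {s : (LDomain Δ ε d U).space.sec W} (hs : s ∈ (LDomain Δ ε d U).homog W k)
    {δ : Finset (Fin n)} (hδ : (δ.card : ℤ) ≠ k) :
    projSec (wt := DIndex.wt) (par := DIndex.par ε) (U := U) (weightVec δ)
      (RSpace.pull (coverMap Δ ε d U) W s) = 0 := by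
  refine sec_ext (wt := DIndex.wt) (par := DIndex.par ε) fun y => ?_
  refine (proj_coverAlgHom Δ ε d (hs _) ?_).trans (map_zero _).symm
  rwa [weightLength_weightVec]

theorem pull_coverHom_mem (W : Opens (LDomain Δ ε d U).space) {k : ℤ}
    {s : (LDomain Δ ε d U).space.sec W} (hs : s ∈ (LDomain Δ ε d U).homog W k) :
    RSpace.pull (coverHom Δ ε d U) W s ∈
      lengthHomog (coverDomain Δ ε d U) (RSpace.preim (coverHom Δ ε d U) W) k := by
  have e := hatSec_eq_sum_projSec (wt := DIndex.wt) (par := DIndex.par ε) (U := U)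
    (RSpace.pull (coverMap Δ ε d U) W s)
  refine Set.mem_of_eq_of_mem (pull_coverHom Δ ε d U W s) (Set.mem_of_eq_of_mem e ?_)
  refine Submodule.sum_mem _ fun δ _ => ?_
  by_cases hδ : (δ.card : ℤ) = k
  · refine Submodule.mem_iSup_of_mem (⟨δ, hδ⟩ : {δ : Finset (Fin n) // (δ.card : ℤ) = k}) ?_
    exact hatSec_mem _ (projSec_mem _ _)
  · refine Set.mem_of_eq_of_mem (congrArg _ (projSec_pull_coverMap Δ ε d U W hs hδ)) ?_
    refine Set.mem_of_eq_of_mem (map_zero _) ?_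
    exact Submodule.zero_mem _

theorem isCovering_coverHom : IsCovering Δ ε d U (coverHom Δ ε d U) where
  morphism :=
    { weight := fun W _ _ hs => pull_coverHom_mem Δ ε d U W hs
      smooth := fun x => ⟨U, 𝟙 _, isChart_id Δ ε (coverDim n d) U, ⟨x, rfl⟩, id, contDiffOn_id,
        fun _ => rfl⟩ }
  base_coord i := (pull_coverHom Δ ε d U ⊤ _).trans
    (congrArg _ (pull_coverMap_x Δ ε d U ⊤ i))
  graded_coord a := ((pull_coverHom Δ ε d U ⊤ _).trans
    (congrArg _ (pull_coverMap_ξ Δ ε d U ⊤ a))).trans (map_sum _ _ _)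

end Covering

/-! ### Morphisms from multiplicity-free manifolds to graded domains -/

section Morphisms

variable {𝕜 : Type} [RCLike 𝕜] {n : ℕ} {Δ : WeightSystem n} {ε : ZMod 2}
  {d : Finset (Fin n) → ℕ} {D : GradedSpace 𝕜 (Fin n → ℤ)} (hD : IsGradedManifold Δ ε d D)
include hD

/-- Morphisms from a multiplicity-free manifold to a graded domain that preserve weight `0` are
determined by the pullbacks of the coordinates. -/
theorem IsGradedManifold.hat_domain_hom_ext {N : ℕ} {ι G : Type} [AddCommGroup G] {wt : ι → G}
    {par : ι → ZMod 2} {U : Opens (Fin N → 𝕜)}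
    {f g : (hat D).space ⟶ (gradedDomain wt par U).space}
    (hf : ∀ W, ∀ s ∈ (gradedDomain wt par U).homog W 0,
      RSpace.pull f W s ∈ (hat D).homog (RSpace.preim f W) 0)
    (hg : ∀ W, ∀ s ∈ (gradedDomain wt par U).homog W 0,
      RSpace.pull g W s ∈ (hat D).homog (RSpace.preim g W) 0)
    (hx : ∀ i, RSpace.pullTo f ⊤ ⊤ (RSpace.le_preim_top f) (baseCoord wt par U ⊤ i) =
      RSpace.pullTo g ⊤ ⊤ (RSpace.le_preim_top g) (baseCoord wt par U ⊤ i))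
    (hξ : ∀ a, RSpace.pullTo f ⊤ ⊤ (RSpace.le_preim_top f) (gradedCoord wt par U ⊤ a) =
      RSpace.pullTo g ⊤ ⊤ (RSpace.le_preim_top g) (gradedCoord wt par U ⊤ a)) : f = g := by
  obtain ⟨E, hE⟩ := hD.exists_hat_eval
  exact domain_hom_ext E (fun A => (hat D).homog A 0) hE
    (fun W A h s => (hat D).res_mem h (hf W _ (funSec_mem W s)))
    (fun W A h s => (hat D).res_mem h (hg W _ (funSec_mem W s))) hx hξ

/-- A homomorphism to the sections of weight `0` of the multiplicity-free quotient lifts to the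
graded manifold. -/
theorem IsGradedManifold.exists_lift_algHom {A : Type} [Ring A] [Algebra 𝕜 A] {W : Opens D.space}
    (F : A →ₐ[𝕜] (hatSpace D).sec W) (hF : ∀ a, F a ∈ hatHomog D W 0) :
    ∃ P : A →ₐ[𝕜] D.space.sec W, ∀ a, P a ∈ D.homog W 0 ∧ hatSec D W (P a) = F a := by
  rw [← weightVec_empty] at hF ⊢
  choose P hP0 hP using fun a => hD.exists_lift (hF a)
  have h0 : ∀ r : 𝕜, algebraMap 𝕜 (D.space.sec W) r ∈ D.homog W (weightVec ∅) := fun r => by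
    rw [Algebra.algebraMap_eq_smul_one, weightVec_empty]
    exact Submodule.smul_mem _ _ (D.one_mem W)
  have h1 : (1 : D.space.sec W) ∈ D.homog W (weightVec ∅) := by
    rw [weightVec_empty]
    exact D.one_mem W
  exact ⟨{  toFun := P
            map_one' := hD.hatSec_injOn (hP0 _) h1 (by rw [hP, map_one, map_one])
            map_mul' := fun a b => hD.hatSec_injOn (hP0 _)
              (by
                have := D.mul_mem (hP0 a) (hP0 b)
                rwa [weightVec_empty, add_zero, ← weightVec_empty] at this)
              (by rw [hP, map_mul, map_mul, hP, hP])
            map_zero' := hD.hatSec_injOn (hP0 _) (Submodule.zero_mem _)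
              (by rw [hP, map_zero, map_zero])
            map_add' := fun a b => hD.hatSec_injOn (hP0 _) (Submodule.add_mem _ (hP0 a) (hP0 b))
              (by rw [hP, map_add, map_add, hP, hP])
            commutes' := fun r => hD.hatSec_injOn (hP0 _) (h0 r)
              (by rw [hP, AlgHom.commutes, AlgHom.commutes]) },
    fun a => ⟨hP0 a, hP a⟩⟩

/-- A morphism of graded manifolds to a graded domain of type `Δ` may be prescribed by a pullback
of functions and by sections of the right weights as the pullbacks of the graded coordinates. -/
theorem IsGradedManifold.exists_gradedMorphism {d' : Finset (Fin n) → ℕ}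
    {U : Opens (Fin (d' ∅) → 𝕜)}
    (φ : D.space.carrier ⟶ (gradedDomain (DIndex.wt : DIndex Δ d' → _)
      (DIndex.par ε) U).space.carrier)
    (P : ∀ W : Opens (gradedDomain (DIndex.wt : DIndex Δ d' → _) (DIndex.par ε) U).space,
      smoothFns DIndex.wt (DIndex.par ε) U W →ₐ[𝕜] D.space.sec ((Opens.map φ).obj W))
    (hP : ∀ W W' (h : W' ≤ W) (g : smoothFns DIndex.wt (DIndex.par ε) U W),
      P W' (smoothRes h g) = D.space.res ((Opens.map φ).map (homOfLE h)).le (P W g))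
    (hP0 : ∀ W g, P W g ∈ D.homog _ 0)
    (f : DIndex Δ d' → D.space.sec ⊤) (hf : ∀ b, f b ∈ D.homog ⊤ (DIndex.wt b)) :
    ∃ Φ : D.space ⟶ (gradedDomain (DIndex.wt : DIndex Δ d' → _) (DIndex.par ε) U).space,
      IsGradedMorphism (X := D) (Y := gradedDomain DIndex.wt (DIndex.par ε) U) Φ ∧
      (∀ W A (hA : A ≤ RSpace.preim Φ W) (hA' : A ≤ (Opens.map φ).obj W)
        (g : smoothFns DIndex.wt (DIndex.par ε) U W),
        RSpace.pullTo Φ W A hA (funSec DIndex.wt (DIndex.par ε) U W g) = D.space.res hA' (P W g)) ∧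
      ∀ W A (hA : A ≤ RSpace.preim Φ W) b,
        RSpace.pullTo Φ W A hA (gradedCoord DIndex.wt (DIndex.par ε) U W b) =
          D.space.res le_top (f b) := by
  let σ : SuperSym 𝕜 (DIndex.par ε : DIndex Δ d' → ZMod 2) →ₐ[𝕜] D.space.sec ⊤ :=
    SuperSym.lift f fun a b => by
      rw [hD.mul_comm_of_mem (hf a) (hf b), DIndex.par_eq, DIndex.par_eq]
  have hσ : ∀ γ, ∀ s ∈ SuperSym.homog 𝕜 (DIndex.par ε) (DIndex.wt : DIndex Δ d' → _) γ,
      σ s ∈ D.homog ⊤ γ := by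
    intro γ s hs
    unfold SuperSym.homog at hs
    induction hs using Submodule.span_induction with
    | mem x hx =>
      obtain ⟨l, rfl, rfl⟩ := hx
      induction l with
      | nil => simpa using D.one_mem ⊤
      | cons a l ih =>
        rw [List.map_cons, List.map_cons, List.prod_cons, List.sum_cons, map_mul]
        refine D.mul_mem ?_ ih
        rw [SuperSym.lift_gen]
        exact hf a
    | zero => rw [map_zero]; exact Submodule.zero_mem _
    | add x y _ _ hx hy => rw [map_add]; exact Submodule.add_mem _ hx hy
    | smul r x _ hx => rw [map_smul]; exact Submodule.smul_mem _ _ hx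
  have hc : ∀ W g s, Commute (P W g) (D.space.res le_top (σ s)) := by
    intro W g s
    induction s using SuperSym.induction with
    | algebraMap r =>
      rw [AlgHom.commutes, AlgHom.commutes]
      exact Algebra.commute_algebraMap_right r _
    | gen b =>
      rw [SuperSym.lift_gen]
      have := hD.mul_comm_of_mem (hP0 W g) (D.res_mem (le_top) (hf b))
      rw [map_zero, ZMod.val_zero, zero_mul, pow_zero, one_smul] at this
      exact this
    | mul a b ha hb =>
      rw [map_mul, map_mul]
      exact ha.mul_right hb
    | add a b ha hb =>
      rw [map_add, map_add]
      exact ha.add_right hb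
  obtain ⟨Φ, hφ, hΦg, hΦs⟩ := exists_domain_hom φ P hP σ hc
  subst hφ
  refine ⟨Φ, ⟨?_, ?_⟩, hΦg, fun W A hA b => ?_⟩
  · intro W γ s hs
    apply D.local_mem
    intro x hx
    obtain ⟨B, hB, hxB, κ, _, g, c, hc, e⟩ := exists_local_sum_of_mem hs (x := RSpace.base Φ x) hx
    have hBW : RSpace.preim Φ B ≤ RSpace.preim Φ W := fun _ h => hB h
    refine ⟨RSpace.preim Φ B, hBW, hxB, ?_⟩
    have e2 : RSpace.pullTo Φ B (RSpace.preim Φ B) le_rfl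
        ((gradedDomain DIndex.wt (DIndex.par ε) U).space.res hB s) =
        D.space.res hBW (RSpace.pull Φ W s) := RSpace.pullTo_res Φ hB le_rfl s
    rw [e, map_sum] at e2
    rw [← e2]
    refine Submodule.sum_mem _ fun k _ => ?_
    rw [map_mul, hΦg B _ le_rfl le_rfl, hΦs, ← zero_add γ]
    exact D.mul_mem (D.res_mem _ (hP0 _ _)) (D.res_mem _ (hσ _ _ (hc k)))
  · -- The value of `s` at the image of `x` is that of its pullback at `x`, which is not `0`.
    rintro W s hs x hx ⟨A, hA, hxA, t, -, ht⟩
    obtain ⟨B, hB, hxB, t', ht', e'⟩ := exists_inv_of_aug_ne_zero (DIndex.strictWt Δ d') hs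
      ⟨RSpace.base Φ x, hx⟩ (by
        intro h0
        obtain ⟨B, hB, hxB, g, e⟩ := exists_funSec (DIndex.strictWt Δ d') hs
          (x := RSpace.base Φ x) hx
        have e1 : smoothVal ⟨RSpace.base Φ x, hxB⟩ g = 0 := by
          have h1 := congrArg (fun s => SuperSym.aug 𝕜 (DIndex.par ε)
            (secVal DIndex.wt (DIndex.par ε) U ⟨RSpace.base Φ x, hxB⟩ s)) e
          simp only [secVal_res, secVal_funSec, map_smul, map_one, smul_eq_mul, mul_one] at h1
          rw [← h1]
          exact h0
        have h2 := (hD.pointEval x).ev_pullTo_funSec Φ (le_refl (RSpace.preim Φ B)) hxB g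
        rw [e1, ← e] at h2
        have hBW : RSpace.preim Φ B ≤ RSpace.preim Φ W := fun _ h => hB h
        have h4 : RSpace.pullTo Φ B (RSpace.preim Φ B) le_rfl
            ((gradedDomain DIndex.wt (DIndex.par ε) U).space.res hB s) =
            D.space.res hBW (RSpace.pull Φ W s) := RSpace.pullTo_res Φ hB le_rfl s
        replace h2 := (congrArg ((hD.pointEval x).ev (RSpace.preim Φ B) hxB) h4).symm.trans h2
        replace h2 := ((hD.pointEval x).ev_res hBW hxB (RSpace.pull Φ W s)).symm.trans h2
        have h3 := congrArg ((hD.pointEval x).ev A hxA) ht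
        rw [map_mul, PointEval.ev_res, h2, zero_mul, map_one] at h3
        exact zero_ne_one h3)
    exact ⟨B, hB, hxB, t', ht', e'⟩
  · rw [gradedCoord_eq, hΦs, SuperSym.lift_gen]

omit hD

/-- A section of length `k` of a multiplicity-free manifold is a sum of components of the
multiplicity-free weights of length `k`. -/
theorem exists_components {W : Opens (hat D).space} {k : ℤ} {s : (hat D).space.sec W}
    (hs : s ∈ lengthHomog D W k) : ∃ c : Finset (Fin n) → (hat D).space.sec W,
      (∀ δ, c δ ∈ (hat D).homog W (weightVec δ)) ∧ (∀ δ, (δ.card : ℤ) ≠ k → c δ = 0) ∧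
      ∑ δ, c δ = s := by
  classical
  unfold lengthHomog at hs
  induction hs using Submodule.iSup_induction' with
  | mem δ x hx =>
    refine ⟨fun δ' => if δ' = δ.1 then x else 0, fun δ' => ?_, fun δ' h => ?_, by simp⟩
    · by_cases h : δ' = δ.1
      · exact Set.mem_of_eq_of_mem (if_pos h) (h ▸ hx)
      · exact Set.mem_of_eq_of_mem (if_neg h) (Submodule.zero_mem _)
    · exact if_neg fun h' => h (by rw [h']; exact δ.2)
  | zero => exact ⟨0, fun _ => Submodule.zero_mem _, fun _ _ => rfl, by simp⟩
  | add x y _ _ hx hy =>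
    obtain ⟨c, hc, hc0, rfl⟩ := hx
    obtain ⟨c', hc', hc0', rfl⟩ := hy
    exact ⟨fun δ => c δ + c' δ, fun δ => Submodule.add_mem _ (hc δ) (hc' δ),
      fun δ h => (congrArg₂ _ (hc0 δ h) (hc0' δ h)).trans (add_zero 0), Finset.sum_add_distrib⟩

theorem lengthHomog_zero_le (W : Opens (hat D).space) :
    lengthHomog D W 0 ≤ (hat D).homog W 0 := by
  refine iSup_le fun δ => ?_
  have : δ.1 = ∅ := Finset.card_eq_zero.1 (by exact_mod_cast δ.2)
  rw [this, weightVec_empty]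

end Morphisms

/-! ### Pullbacks under induced morphisms -/

section InducedMorphisms

variable {𝕜 : Type} [RCLike 𝕜] {n : ℕ} {D D' : GradedSpace 𝕜 (Fin n → ℤ)}
  {Ψ : hatSpace D ⟶ hatSpace D'} {Φ : D.space ⟶ D'.space}

/-- An induced morphism pulls classes back to the classes of the pullbacks. -/
theorem pullTo_hatSec (e : Ψ ≫ hatι D' = hatι D ≫ Φ) (W : Opens D'.space) (A : Opens D.space)
    (hΨ : A ≤ RSpace.preim Ψ W) (hΦ : A ≤ RSpace.preim Φ W) (s : D'.space.sec W) :
    RSpace.pullTo Ψ W A hΨ (hatSec D' W s) = hatSec D A (RSpace.pullTo Φ W A hΦ s) := by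
  have h1 : RSpace.pullTo (hatι D ≫ Φ) W A hΦ s = hatSec D A (RSpace.pullTo Φ W A hΦ s) :=
    pullTo_hatι_comp Φ W A hΦ s
  have h2 : RSpace.pullTo (Ψ ≫ hatι D') W A hΨ s = RSpace.pullTo Ψ W A hΨ (hatSec D' W s) := rfl
  exact h2.symm.trans ((RSpace.pullTo_eq_of_eq e hΨ s).trans h1)

/-- Induced morphisms preserve the weights. -/
theorem pull_hat_mem (e : Ψ ≫ hatι D' = hatι D ≫ Φ)
    (hΦ : ∀ (W : Opens D'.space) (γ : Fin n → ℤ) (s : D'.space.sec W), s ∈ D'.homog W γ →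
      RSpace.pull Φ W s ∈ D.homog (RSpace.preim Φ W) γ) {W : Opens D'.space} {γ : Fin n → ℤ}
    {s : (hatSpace D').sec W} (hs : s ∈ hatHomog D' W γ) :
    RSpace.pull Ψ W s ∈ (hat D).homog (RSpace.preim Ψ W) γ := by
  let pre : Opens D'.space → Opens D.space := fun W =>
    RSpace.preim (X := hatSpace D) (Y := hatSpace D') Ψ W
  have hb : ∀ x : D.space, (RSpace.base (X := hatSpace D) (Y := hatSpace D') Ψ x :
      D'.space) = RSpace.base Φ x := fun x =>
    congrArg (fun k : hatSpace D ⟶ D'.space => (RSpace.base k x : D'.space)) e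
  intro x hx
  obtain ⟨A, hA, hxA, f, hf, e'⟩ := hs (RSpace.base (X := hatSpace D) (Y := hatSpace D') Ψ x) hx
  have hΦA : pre A ≤ RSpace.preim Φ A := fun y hy => by
    have hy' : (RSpace.base (X := hatSpace D) (Y := hatSpace D') Ψ y : D'.space) ∈ A := hy
    rw [hb] at hy'
    exact hy'
  have hpre : pre A ≤ pre W := fun _ h => hA h
  refine ⟨pre A, hpre, hxA, RSpace.pullTo Φ A (pre A) hΦA f, D.res_mem hΦA (hΦ A γ f hf), ?_⟩
  exact (RSpace.pullTo_res (Y := hatSpace D') Ψ hA (A := pre A) le_rfl s).symm.trans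
    ((congrArg (RSpace.pullTo (Y := hatSpace D') Ψ A (pre A) le_rfl) e').trans
      (pullTo_hatSec e A (pre A) le_rfl hΦA f))

/-- In an independent family of submodules, components are determined by their sum. -/
theorem eq_of_sum_eq {R M κ : Type*} [Ring R] [AddCommGroup M] [Module R M] [Fintype κ]
    {H : κ → Submodule R M} (hH : ∀ u : κ → M, (∀ i, u i ∈ H i) → ∑ i, u i = 0 → ∀ i, u i = 0)
    {q : κ → Prop} [Fintype {i // q i}] {s t : {i // q i} → M} (hs : ∀ i, s i ∈ H i.1)
    (ht : ∀ i, t i ∈ H i.1) (h : ∑ i, s i = ∑ i, t i) (i : {i // q i}) : s i = t i := by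
  classical
  let u : κ → M := fun i => if hi : q i then s ⟨i, hi⟩ - t ⟨i, hi⟩ else 0
  have hu : ∀ i, u i ∈ H i := by
    intro i
    by_cases hi : q i
    · exact Set.mem_of_eq_of_mem (dif_pos hi) (Submodule.sub_mem _ (hs ⟨i, hi⟩) (ht ⟨i, hi⟩))
    · exact Set.mem_of_eq_of_mem (dif_neg hi) (Submodule.zero_mem _)
  have hui : ∀ i : {i // q i}, s i - t i = u i.1 := fun i => by
    simp only [u, dif_pos i.2]
  have hu0 : ∑ i, u i = 0 := by
    rw [← Fintype.sum_of_injective (Subtype.val : {i // q i} → _) Subtype.val_injective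
      (fun i => s i - t i) u (fun i hi => dif_neg fun h => hi ⟨⟨i, h⟩, rfl⟩) hui,
      Finset.sum_sub_distrib, h, sub_self]
  exact sub_eq_zero.1 ((hui i).trans (hH u hu hu0 i.1))

end InducedMorphisms

/-! ### The universal property of the covering -/

section Universal

variable {𝕜 : Type} [RCLike 𝕜] {n : ℕ} {Δ : WeightSystem n} {ε : ZMod 2} {d : ℕ → ℕ}
  {U : Opens (Fin (d 0) → 𝕜)}
  {p : (hat (coverDomain Δ ε d U)).space ⟶ (LDomain Δ ε d U).space}

theorem LDomain.ξ_mem (W : Opens (LDomain Δ ε d U).space) (a : LIndex Δ d) :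
    LDomain.ξ Δ ε d U W a ∈ (LDomain Δ ε d U).homog W a.1.1 :=
  fun _ => SuperSym.gen_mem_homog LIndex.wt a

theorem DDomain.t_mem (W : Opens (coverDomain Δ ε d U).space) (b : DIndex Δ (coverDim n d)) :
    DDomain.t Δ ε (coverDim n d) U W b ∈ (coverDomain Δ ε d U).homog W (weightVec b.1.1) :=
  fun _ => SuperSym.gen_mem_homog DIndex.wt b

theorem IsCovering.pullTo_x (hp : IsCovering Δ ε d U p) (i : Fin (d 0)) :
    RSpace.pullTo p ⊤ ⊤ (RSpace.le_preim_top p) (LDomain.x Δ ε d U ⊤ i) =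
      hatSec (coverDomain Δ ε d U) ⊤ (DDomain.y Δ ε (coverDim n d) U ⊤ i) :=
  (congrArg ((hat (coverDomain Δ ε d U)).space.res (RSpace.le_preim_top p))
    (hp.base_coord i)).trans (res_hatSec (coverDomain Δ ε d U) (RSpace.le_preim_top p) _)

theorem IsCovering.pullTo_ξ (hp : IsCovering Δ ε d U p) (a : LIndex Δ d) :
    RSpace.pullTo p ⊤ ⊤ (RSpace.le_preim_top p) (LDomain.ξ Δ ε d U ⊤ a) =
      ∑ δ, hatSec (coverDomain Δ ε d U) ⊤
        (DDomain.t Δ ε (coverDim n d) U ⊤ (coverIndex Δ d a δ)) :=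
  (congrArg ((hat (coverDomain Δ ε d U)).space.res (RSpace.le_preim_top p))
    (hp.graded_coord a)).trans ((map_sum _ _ _).trans (Finset.sum_congr rfl fun _ _ =>
      res_hatSec (coverDomain Δ ε d U) (RSpace.le_preim_top p) _))

theorem IsMorphismToGraded.weight_zero {dM : Finset (Fin n) → ℕ}
    {D : GradedSpace 𝕜 (Fin n → ℤ)} {ψ : (hat D).space ⟶ (LDomain Δ ε d U).space}
    (hψ : IsMorphismToGraded Δ ε dM D d U ψ) (W : Opens (LDomain Δ ε d U).space)
    (s : (LDomain Δ ε d U).space.sec W) (hs : s ∈ (LDomain Δ ε d U).homog W 0) :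
    RSpace.pull ψ W s ∈ (hat D).homog (RSpace.preim ψ W) 0 :=
  lengthHomog_zero_le _ (hψ.weight W 0 s hs)

/-- The covering morphism is determined by its values on the coordinates. -/
theorem IsCovering.eq {p' : (hat (coverDomain Δ ε d U)).space ⟶ (LDomain Δ ε d U).space}
    (hp : IsCovering Δ ε d U p) (hp' : IsCovering Δ ε d U p') : p = p' :=
  (isGradedManifold_domain Δ ε (coverDim n d) U).hat_domain_hom_ext (wt := LIndex.wt)
    (par := LIndex.par ε) (U := U) hp.morphism.weight_zero hp'.morphism.weight_zero
    (fun i => (hp.pullTo_x i).trans (hp'.pullTo_x i).symm)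
    (fun a => (hp.pullTo_ξ a).trans (hp'.pullTo_ξ a).symm)

variable {D : GradedSpace 𝕜 (Fin n → ℤ)} {Ψ : (hat D).space ⟶ (hat (coverDomain Δ ε d U)).space}
  {Φ : D.space ⟶ (coverDomain Δ ε d U).space}

theorem IsCovering.pullTo_comp_x (hp : IsCovering Δ ε d U p)
    (e : Ψ ≫ hatι (coverDomain Δ ε d U) = hatι D ≫ Φ) (i : Fin (d 0)) :
    RSpace.pullTo (Ψ ≫ p) ⊤ ⊤ (RSpace.le_preim_top (Ψ ≫ p)) (LDomain.x Δ ε d U ⊤ i) =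
      hatSec D ⊤ (RSpace.pullTo Φ ⊤ ⊤ (RSpace.le_preim_top Φ)
        (DDomain.y Δ ε (coverDim n d) U ⊤ i)) :=
  (RSpace.pullTo_comp Ψ p ⊤ ⊤ (RSpace.le_preim_top p) ⊤ (RSpace.le_preim_top Ψ) _).trans
    ((congrArg _ (hp.pullTo_x i)).trans
      (pullTo_hatSec e ⊤ ⊤ (RSpace.le_preim_top Ψ) (RSpace.le_preim_top Φ) _))

theorem IsCovering.pullTo_comp_ξ (hp : IsCovering Δ ε d U p)
    (e : Ψ ≫ hatι (coverDomain Δ ε d U) = hatι D ≫ Φ) (a : LIndex Δ d) :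
    RSpace.pullTo (Ψ ≫ p) ⊤ ⊤ (RSpace.le_preim_top (Ψ ≫ p)) (LDomain.ξ Δ ε d U ⊤ a) =
      ∑ δ, hatSec D ⊤ (RSpace.pullTo Φ ⊤ ⊤ (RSpace.le_preim_top Φ)
        (DDomain.t Δ ε (coverDim n d) U ⊤ (coverIndex Δ d a δ))) :=
  (RSpace.pullTo_comp Ψ p ⊤ ⊤ (RSpace.le_preim_top p) ⊤ (RSpace.le_preim_top Ψ) _).trans
    ((congrArg _ (hp.pullTo_ξ a)).trans ((map_sum _ _ _).trans (Finset.sum_congr rfl fun _ _ =>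
      pullTo_hatSec e ⊤ ⊤ (RSpace.le_preim_top Ψ) (RSpace.le_preim_top Φ) _)))

/-- The index `(#δ, j)` of the coordinate whose pullback to the covering has `t^δ_j` as a
component. -/
def DIndex.orbit (b : DIndex Δ (coverDim n d)) : LIndex Δ d :=
  ⟨⟨b.1.1.card, Finset.mem_erase.2 ⟨fun h => b.1.2.2 (Finset.card_eq_zero.1 h),
    Finset.mem_image_of_mem _ b.1.2.1⟩⟩, b.2⟩

theorem DIndex.orbit_coverIndex (a : LIndex Δ d)
    (δ : {δ : Finset (Fin n) // δ ∈ Δ.1 ∧ δ.card = a.1.1}) :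
    DIndex.orbit (coverIndex Δ d a δ) = a := by
  obtain ⟨⟨k, hk⟩, j⟩ := a
  obtain ⟨δ, hδ, hk'⟩ := δ
  change δ.card = k at hk'
  subst hk'
  rfl

/-- A morphism of multiplicity-free manifolds to the covering is determined by its composition
with the covering morphism: the pullbacks of the `t^δ_j` are the components of the pullback of
`ξ^k_j`. -/
theorem IsCovering.hom_ext {dM : Finset (Fin n) → ℕ} (hD : IsGradedManifold Δ ε dM D)
    (hp : IsCovering Δ ε d U p) {Ψ' : (hat D).space ⟶ (hat (coverDomain Δ ε d U)).space}
    (hΨ : IsMultFreeMorphism Ψ) (hΨ' : IsMultFreeMorphism Ψ') (h : Ψ ≫ p = Ψ' ≫ p) : Ψ = Ψ' := by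
  obtain ⟨Φ, hΦ, e⟩ := hΨ
  obtain ⟨Φ', hΦ', e'⟩ := hΨ'
  have hw : ∀ {F : D.space ⟶ (coverDomain Δ ε d U).space},
      IsGradedMorphism (X := D) (Y := coverDomain Δ ε d U) F → ∀ W,
      ∀ s ∈ (coverDomain Δ ε d U).homog W 0,
        RSpace.pull (hatι D ≫ F) W s ∈ (hat D).homog (RSpace.preim (hatι D ≫ F) W) 0 :=
    fun hF W s hs => hatSec_mem _ (hF.weight W 0 s hs)
  refine hat_hom_ext (e.trans (Eq.trans ?_ e'.symm))
  refine hD.hat_domain_hom_ext (wt := DIndex.wt) (par := DIndex.par ε) (U := U) (hw hΦ) (hw hΦ')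
    (fun i => ?_) fun b => ?_
  · refine (pullTo_hatι_comp Φ _ _ _ _).trans (Eq.trans ?_ (pullTo_hatι_comp Φ' _ _ _ _).symm)
    exact (hp.pullTo_comp_x e i).symm.trans
      ((RSpace.pullTo_eq_of_eq h _ _).trans (hp.pullTo_comp_x e' i))
  · refine (pullTo_hatι_comp Φ _ _ _ _).trans (Eq.trans ?_ (pullTo_hatι_comp Φ' _ _ _ _).symm)
    have hsum := (hp.pullTo_comp_ξ e b.orbit).symm.trans
      ((RSpace.pullTo_eq_of_eq h _ _).trans (hp.pullTo_comp_ξ e' b.orbit))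
    have ht : ∀ {F : D.space ⟶ (coverDomain Δ ε d U).space},
        IsGradedMorphism (X := D) (Y := coverDomain Δ ε d U) F → ∀ δ,
        hatSec D ⊤ (RSpace.pullTo F ⊤ ⊤ (RSpace.le_preim_top F)
          (DDomain.t Δ ε (coverDim n d) U ⊤ (coverIndex Δ d b.orbit δ))) ∈
            hatHomog D ⊤ (weightVec δ.1) := fun hF δ =>
      hatSec_mem _ (D.res_mem _ (hF.weight ⊤ _ _ (DDomain.t_mem ⊤ (coverIndex Δ d b.orbit δ))))
    exact eq_of_sum_eq (H := fun δ => hatHomog D ⊤ (weightVec δ))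
      (fun u hu h0 => hD.hat_eq_zero_of_sum_eq_zero hu h0) (ht hΦ) (ht hΦ') hsum
      ⟨b.1.1, b.1.2.1, rfl⟩

/-- A morphism to the graded domain factors through the covering: each coordinate `t^δ_j` pulls
back to the component of weight `δ` of the pullback of `ξ^k_j`. The invariance of `Δ` ensures
that no component is lost. -/
theorem IsCovering.exists_factorization (hΔ : Δ.Invariant) {dM : Finset (Fin n) → ℕ}
    (hD : IsGradedManifold Δ ε dM D) (hp : IsCovering Δ ε d U p)
    {ψ : (hat D).space ⟶ (LDomain Δ ε d U).space} (hψ : IsMorphismToGraded Δ ε dM D d U ψ) :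
    ∃ Ψ : (hat D).space ⟶ (hat (coverDomain Δ ε d U)).space,
      IsMultFreeMorphism Ψ ∧ Ψ ≫ p = ψ := by
  let φ : D.space.carrier ⟶ (gradedDomain (DIndex.wt : DIndex Δ (coverDim n d) → _)
      (DIndex.par ε) U).space.carrier := ψ.hom.base
  have hF : ∀ W : Opens (LDomain Δ ε d U).space, ∀ g : smoothFns LIndex.wt (LIndex.par ε) U W,
      RSpace.pull ψ W (funSec LIndex.wt (LIndex.par ε) U W g) ∈
        (hat D).homog (RSpace.preim ψ W) 0 := fun W g =>
    hψ.weight_zero W _ (funSec_mem W g)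
  have hP : ∀ W : Opens (gradedDomain (DIndex.wt : DIndex Δ (coverDim n d) → _)
      (DIndex.par ε) U).space, ∃ P : smoothFns DIndex.wt (DIndex.par ε) U W →ₐ[𝕜]
        D.space.sec ((Opens.map φ).obj W), ∀ g, P g ∈ D.homog ((Opens.map φ).obj W) 0 ∧
          hatSec D ((Opens.map φ).obj W) (P g) = RSpace.pull ψ W
            (funSec LIndex.wt (LIndex.par ε) U W ((smoothFnsCover Δ ε d U W).symm g)) := by
    intro W
    exact hD.exists_lift_algHom (W := (Opens.map φ).obj W) (((RSpace.pull ψ W).comp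
      (funSec LIndex.wt (LIndex.par ε) U W)).comp (smoothFnsCover Δ ε d U W).symm.toAlgHom)
      fun g => hF W _
  choose P hP using hP
  -- The components of `ψ^* ξ_a`, lifted to `D`.
  have hc : ∀ a : LIndex Δ d, ∃ c : Finset (Fin n) → D.space.sec ⊤,
      (∀ δ, c δ ∈ D.homog ⊤ (weightVec δ)) ∧
      (∀ δ : Finset (Fin n), δ.card ≠ a.1.1 → hatSec D ⊤ (c δ) = 0) ∧
      ∑ δ, hatSec D ⊤ (c δ) =
        RSpace.pullTo ψ ⊤ ⊤ (RSpace.le_preim_top ψ) (LDomain.ξ Δ ε d U ⊤ a) := by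
    intro a
    obtain ⟨c, hc, hc0, e⟩ := exists_components
      (hψ.weight ⊤ _ _ (LDomain.ξ_mem ⊤ a))
    choose f hf hfc using fun δ => hD.exists_lift
      ((hat D).res_mem (RSpace.le_preim_top ψ) (hc δ))
    refine ⟨f, hf, fun δ hδ => ?_, ?_⟩
    · refine (hfc δ).trans ((congrArg _ (hc0 δ fun h => hδ ?_)).trans (map_zero _))
      exact_mod_cast h
    · exact (Finset.sum_congr rfl fun δ _ => hfc δ).trans ((map_sum _ _ _).symm.trans
        (congrArg ((hat D).space.res (RSpace.le_preim_top ψ)) e))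
  choose c hcw hc0 hcsum using hc
  obtain ⟨Φ, hΦ, hΦg, hΦc⟩ := hD.exists_gradedMorphism φ P (fun W W' h g => by
      refine hD.hatSec_injOn (δ := ∅) (by rw [weightVec_empty]; exact (hP W' _).1)
        (by rw [weightVec_empty]; exact D.res_mem _ (hP W g).1) ?_
      refine (hP W' _).2.trans (Eq.trans ?_ (res_hatSec D _ _))
      refine (RSpace.pull_res ψ h (funSec LIndex.wt (LIndex.par ε) U W
        ((smoothFnsCover Δ ε d U W).symm g))).trans ?_
      exact congrArg ((hat D).space.res _) (hP W g).2.symm)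
    (fun W g => (hP W g).1) (fun b => c b.orbit b.1.1) (fun b => hcw _ _)
  obtain ⟨Ψ, e⟩ := exists_hat_hom Φ hΦ.weight
  refine ⟨Ψ, ⟨Φ, hΦ, e⟩, ?_⟩
  refine hD.hat_domain_hom_ext (wt := LIndex.wt) (par := LIndex.par ε) (U := U)
    (fun W s hs => pull_hat_mem (Ψ := Ψ) e hΦ.weight (hp.morphism.weight_zero W s hs))
    hψ.weight_zero (fun i => ?_) fun a => ?_
  · refine (hp.pullTo_comp_x e i).trans ?_
    refine (congrArg (hatSec D ⊤) (hΦg ⊤ ⊤ (RSpace.le_preim_top Φ) le_top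
      (smoothCoord ⊤ i))).trans ?_
    refine (res_hatSec D _ _).symm.trans ?_
    exact congrArg ((hat D).space.res (RSpace.le_preim_top ψ)) (hP ⊤ (smoothCoord ⊤ i)).2
  · refine (hp.pullTo_comp_ξ e a).trans (Eq.trans ?_ (hcsum a))
    refine Fintype.sum_of_injective Subtype.val Subtype.val_injective _ _
      (fun δ hδ => hc0 a δ fun h => hδ ⟨⟨δ, hΔ.mem_of_card a.1.2 h, h⟩, rfl⟩) fun δ => ?_
    refine congrArg (hatSec D ⊤) ((hΦc ⊤ ⊤ (RSpace.le_preim_top Φ) (coverIndex Δ d a δ)).trans ?_)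
    rw [RSpace.res_self, DIndex.orbit_coverIndex]
    rfl

end Universal

end MultFree

end

theorem mainTheorem10 (𝕜 : Type) [RCLike 𝕜] (n : ℕ) (Δ : MultFree.WeightSystem n)
    (hΔ : Δ.Invariant) (ε : ZMod 2) (d : ℕ → ℕ) (U : TopologicalSpace.Opens (Fin (d 0) → 𝕜)) :
    MultFree.IsGradedManifold Δ ε (MultFree.coverDim n d) (MultFree.coverDomain Δ ε d U) ∧
    ∃ p : (MultFree.hat (MultFree.coverDomain Δ ε d U)).space ⟶ (MultFree.LDomain Δ ε d U).space,
      MultFree.IsCovering Δ ε d U p ∧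
      (∀ p', MultFree.IsCovering Δ ε d U p' → p' = p) ∧
      ∀ (dM : Finset (Fin n) → ℕ) (D : MultFree.GradedSpace 𝕜 (Fin n → ℤ)),
        MultFree.IsGradedManifold Δ ε dM D →
        ∀ ψ : (MultFree.hat D).space ⟶ (MultFree.LDomain Δ ε d U).space,
          MultFree.IsMorphismToGraded Δ ε dM D d U ψ →
          ∃! Ψ : (MultFree.hat D).space ⟶ (MultFree.hat (MultFree.coverDomain Δ ε d U)).space,
            MultFree.IsMultFreeMorphism Ψ ∧ Ψ ≫ p = ψ := by
  have hp := MultFree.isCovering_coverHom Δ ε d U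
  refine ⟨MultFree.isGradedManifold_domain Δ ε (MultFree.coverDim n d) U, _, hp,
    fun p' hp' => hp'.eq hp, fun dM D hD ψ hψ => ?_⟩
  obtain ⟨Ψ, hΨ, e⟩ := hp.exists_factorization hΔ hD hψ
  exact ⟨Ψ, ⟨hΨ, e⟩, fun Ψ' h => hp.hom_ext hD h.1 hΨ (h.2.trans e.symm)⟩
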